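/- **Thom's folding.** Let $\Delta$ be a simplex with finite vertex set $I$, with barycentric coordinates. Its Thom subdivision $K$ is the standard chromatic subdivision: for $i\in S\subseteq I$ let $v(i,S)\in\Delta$ be the point whose coordinates are $\frac{1}{2|S|-1}$ at $i$, $\frac{2}{2|S|-1}$ at the elements of $S\setminus\{i\}$, and $0$ elsewhere; the maximal simplices of $K$ are the simplices with vertices $v(i,S_i)$, $i\in I$, where $i\in S_i$, the sets $S_i$ form a chain for inclusion, and $j\in S_i$ implies $S_j\subseteq S_i$. The folding map $s:\Delta\to\Delta$ is affine on each simplex of $K$ and sends $v(i,S)$ to $i$. Let $s^{(r)}$ be the $r$-th iterate of $s$, let $K^{(0)}$ be $\Delta$ with its faces, and $K^{(r+1)}=(s^{(r)})^{-1}(K)$. These are compatible with passing to faces, so for every triangulation $T$ of a manifold $X$ they define, in barycentric coordinates, the $r$-th Thom subdivision of $T$ and a folding map $s^{(r)}:X\to X$ preserving each simplex of $T$. **Setting.** Let $X$ be a smooth Hausdorff $n$-manifold without boundary with a smooth Riemannian metric, let $\rho:X\to(0,\infty)$ be continuous, and let $DX=\{(x,u)\in TX: |u|<\rho(x)\}$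 with fibres $D_xX$. Assume that the exponential map is defined on $DX$, that $\exp:DX\to X$ is a (smooth) submersion, and that for each $x$ its restriction $\exp_x:D_xX\to X$ is an injective immersion. Let $\mathcal F_{\exp}$ be the exponential foliation of $DX$, whose leaves are the connected components of the fibres of $\exp:DX\to X$; its tangent space is $\ker d\exp$. Let $T$ be a smooth triangulation of $X$ (a locally finite simplicial complex with a homeomorphism from its realization to $X$ which is a smooth embedding on each closed simplex) which is fine: for every simplex $\sigma$ of $T$ and every $x\in\sigma$, $\sigma\subseteq\exp_x(D_xX)$. The $r$-th jiggling is $$j^{(r)}(x)=\exp_x^{-1}\bigl(s^{(r)}(x)\bigr)\in D_xX .$$ A section $j$ of $DX$ is quasi-transverse to a field $P$ of $n$-planes on $DX$ (relative to the $r$-th Thom subdivision) if for each simplex $\tau$ of the $r$-th Thom subdivision of $T$, no nonzero tangent vector to $j(\tau)$ lies in $P$. **Theorem.** 1. For every $r$, $j^{(r)}$ is a well-defined continuous section of $DX$ whose restriction to each simplex of the $r$-th Thom subdivision of $T$ is smooth; and $\exp\circ j^{(r)}=s^{(r)}$. 2. The larger $r$ is, the more vertical $j^{(r)}$ is: for each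 simplex $\sigma$ of $T$ and each $\varepsilon>0$ there is $r_0$ such that for all $r\ge r_0$, all simplices $\tau\subseteq\sigma$ of the $r$-th Thom subdivision and all tangent vectors $z$ to $j^{(r)}(\tau)$, $|d\pi(z)|\le\varepsilon\,|d\exp(z)|$, where $\pi:TX\to X$ is the projection. 3. There is $r_0$ such that for all $r\ge r_0$, $j^{(r)}$ is quasi-transverse to the tangent spaces $\ker d\exp$ of the leaves of $\mathcal F_{\exp}$. 4. If $X$ is compact, then for every compact topological space $A$ and every family $(P_a)_{a\in A}$ of $n$-plane fields on $DX$, jointly continuous in the parameter $a$ and the point of $DX$ and transverse to the fibres of $TX$, there is $r_0$ such that for all $r\ge r_0$ and all $a\in A$, $j^{(r)}$ is quasi-transverse to $P_a$. -/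

import Mathlib

open Set Topology Manifold Bundle
open scoped ContDiff

noncomputable section

namespace Jiggling

/-! ### Thom's subdivision of a simplex and its folding map

The standard simplex with vertex set `ι` is `stdSimplex ℝ ι`, in barycentric coordinates. Thom's
subdivision is the standard chromatic subdivision: its vertices are the pairs `(i, S)`
with `i ∈ S ⊆ ι`, where `i` is the colour and `S` spans the face whose interior contains the
vertex; its top-dimensional simplices are the "immediate snapshots". -/

section Fold

variable {ι : Type*} [Fintype ι]

open Classical in
/-- The vertex of colour `i` of the small upside-down simplex placed inside the face spanned by
`S` (for `S = {i}` it is the vertex `i` itself). Its weight at `i` is smaller than its weights at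
the other elements of `S`, so that it is close to the facet of `S` opposite to `i`. -/
def chromaticVertex (i : ι) (S : Finset ι) : ι → ℝ := fun j =>
  if j ∈ S then (if j = i then 1 else 2) / (2 * (S.card : ℝ) - 1) else 0

/-- The top-dimensional simplices of the chromatic subdivision: for each colour `i` there is one
vertex `(i, S i)`, subject to self-inclusion, containment and immediacy. -/
structure IsSnapshot (S : ι → Finset ι) : Prop where
  self_mem : ∀ i, i ∈ S i
  chain : ∀ i j, S i ⊆ S j ∨ S j ⊆ S i
  immediate : ∀ i j, j ∈ S i → S j ⊆ S i

variable (ι) in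
/-- The simplices of Thom's subdivision `K` of the standard simplex, as subsets of it. -/
def thomSubdivision : Set (Set (ι → ℝ)) :=
  {κ | ∃ S : ι → Finset ι, IsSnapshot S ∧ ∃ J : Finset ι, J.Nonempty ∧
    κ = convexHull ℝ ((fun i => chromaticVertex i (S i)) '' (J : Set ι))}

open Classical in
/-- Thom's folding map `s` of the standard simplex: it is affine on each simplex of the subdivision
and maps the vertex `(i, S)` of colour `i` to the vertex `i`. -/
def thomFold (x : ι → ℝ) : ι → ℝ :=
  if h : ∃ t ∈ stdSimplex ℝ ι, ∃ S : ι → Finset ι, IsSnapshot S ∧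
      x = ∑ i, t i • chromaticVertex i (S i)
  then h.choose else x

open Classical in
variable (ι) in
/-- The simplices of the `r`-th Thom subdivision `K⁽ʳ⁾` of the standard simplex: `K⁽⁰⁾` is the
simplex with its faces, and `K⁽ʳ⁺¹⁾` is the preimage of `K` under `s⁽ʳ⁾`, where `s⁽ʳ⁾ = s ∘ ⋯ ∘ s`
is affine on each simplex of `K⁽ʳ⁾`. -/
def iteratedThomSubdivision : ℕ → Set (Set (ι → ℝ))
  | 0 => {τ | ∃ J : Finset ι, J.Nonempty ∧
      τ = convexHull ℝ ((fun i => (Pi.single i 1 : ι → ℝ)) '' (J : Set ι))}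
  | r + 1 => {τ | ∃ ρ ∈ iteratedThomSubdivision r, ∃ κ ∈ thomSubdivision ι,
      κ ⊆ (thomFold^[r]) '' ρ ∧ τ = {p ∈ ρ | (thomFold^[r]) p ∈ κ}}

end Fold

/-! ### Riemannian geodesics and the exponential map -/

variable {n : ℕ} {X : Type*} [TopologicalSpace X] [ChartedSpace (EuclideanSpace ℝ (Fin n)) X]

section Riemannian

variable [IsManifold (𝓡 n) ∞ X]

variable (n X) in
/-- Smooth Riemannian metrics on an `n`-manifold `X`. -/
abbrev Metric : Type _ :=
  ContMDiffRiemannianMetric (𝓡 n) ∞ (EuclideanSpace ℝ (Fin n))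
    (fun x : X => TangentSpace (𝓡 n) x)

variable (g : Metric n X)

/-- The Riemannian length of a tangent vector. -/
def length {x : X} (v : TangentSpace (𝓡 n) x) : ℝ := √(g.inner x v v)

/-- The metric tensor in the preferred chart at `x₀`, as a function of the coordinates. -/
def metricInChart (x₀ : X) (y : EuclideanSpace ℝ (Fin n)) :
    EuclideanSpace ℝ (Fin n) →L[ℝ] EuclideanSpace ℝ (Fin n) →L[ℝ] ℝ :=
  let A : EuclideanSpace ℝ (Fin n) →L[ℝ] EuclideanSpace ℝ (Fin n) :=
    mfderiv 𝓘(ℝ, EuclideanSpace ℝ (Fin n)) (𝓡 n) (extChartAt (𝓡 n) x₀).symm y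
  let B : EuclideanSpace ℝ (Fin n) →L[ℝ] EuclideanSpace ℝ (Fin n) →L[ℝ] ℝ :=
    g.inner ((extChartAt (𝓡 n) x₀).symm y)
  B.bilinearComp A A

/-- `γ` is a smooth geodesic on the open set `J` of times: in a chart around `γ t`, where the
curve reads `c` and the metric reads `G`, one has for every vector `w`
`G(c'', w) + (∂_{c'} G)(c', w) - ½ (∂_w G)(c', c') = 0`, which is
`∑ G_{kl} (c''ˡ + ∑ Γˡ_{ij} c'ⁱ c'ʲ) wᵏ = 0`. -/
def IsGeodesicOn (γ : ℝ → X) (J : Set ℝ) : Prop :=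
  ContMDiffOn 𝓘(ℝ, ℝ) (𝓡 n) ∞ γ J ∧
  ∀ t ∈ J, ∀ w : EuclideanSpace ℝ (Fin n),
    let c : ℝ → EuclideanSpace ℝ (Fin n) := fun s => extChartAt (𝓡 n) (γ t) (γ s)
    let G := metricInChart g (γ t)
    G (c t) (deriv (deriv c) t) w + fderiv ℝ G (c t) (deriv c t) (deriv c t) w
      - 1 / 2 * fderiv ℝ G (c t) w (deriv c t) (deriv c t) = 0

/-- `γ` is a geodesic, defined on an open interval containing `[0, 1]`, with initial position and
velocity given by the tangent vector `w`. -/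
def IsGeodesicFrom (w : TangentBundle (𝓡 n) X) (γ : ℝ → X) : Prop :=
  (∃ ε > 0, IsGeodesicOn g γ (Ioo (-ε) (1 + ε))) ∧
  (⟨γ 0, mfderiv 𝓘(ℝ, ℝ) (𝓡 n) γ 0 (1 : ℝ)⟩ : TangentBundle (𝓡 n) X) = w

open Classical in
/-- The Riemannian exponential map `exp : TX → X`. The value is only meaningful if the geodesic
with initial vector `w` exists up to time `1`. -/
def expMap (w : TangentBundle (𝓡 n) X) : X :=
  if h : ∃ γ : ℝ → X, IsGeodesicFrom g w γ then h.choose 1 else w.proj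

/-- The open disc bundle of radius function `ρ` in `TX`. -/
def discBundle (ρ : X → ℝ) : Set (TangentBundle (𝓡 n) X) :=
  {w | length g w.snd < ρ w.proj}

/-- The open disc `D_x X ⊆ T_x X`. -/
def disc (ρ : X → ℝ) (x : X) : Set (TangentSpace (𝓡 n) x) :=
  {v | (⟨x, v⟩ : TangentBundle (𝓡 n) X) ∈ discBundle g ρ}

/-- The tangent space to the fibre of `TX → X`, inside the tangent space of `TX`. -/
def verticalSpace (w : TangentBundle (𝓡 n) X) :
    Submodule ℝ (TangentSpace (𝓡 n).tangent w) :=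
  LinearMap.ker (mfderiv (𝓡 n).tangent (𝓡 n)
    (TotalSpace.proj : TangentBundle (𝓡 n) X → X) w).toLinearMap

/-- The tangent space to the leaf through `w` of the exponential foliation, whose leaves are the
connected components of the fibres of the submersion `exp`. -/
def expFoliation (w : TangentBundle (𝓡 n) X) :
    Submodule ℝ (TangentSpace (𝓡 n).tangent w) :=
  LinearMap.ker (mfderiv (𝓡 n).tangent (𝓡 n) (expMap g) w).toLinearMap

/-- The disc bundle `DX` of radius `ρ` is admissible: `exp` is defined on `DX`, it is a submersion
`DX → X`, and its restriction to each disc `D_x X` is an injective immersion. -/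
structure IsAdmissible (ρ : X → ℝ) : Prop where
  continuous : Continuous ρ
  pos : ∀ x, 0 < ρ x
  exp_defined : ∀ w ∈ discBundle g ρ, ∃ γ : ℝ → X, IsGeodesicFrom g w γ
  submersion : ∀ w ∈ discBundle g ρ, IsSubmersionAt (𝓡 n).tangent (𝓡 n) ∞ (expMap g) w
  injOn : ∀ x, InjOn (fun v : TangentSpace (𝓡 n) x => expMap g ⟨x, v⟩) (disc g ρ x)
  immersive : ∀ w ∈ discBundle g ρ, Disjoint (verticalSpace w) (expFoliation g w)

end Riemannian

/-! ### Smooth triangulations, the folding of `X`, and the jiggling -/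

/-- Extension by zero of barycentric coordinates on the simplex `σ`. -/
def extendCoord {V : Type*} {σ : Finset V} (p : σ → ℝ) : V → ℝ :=
  Function.extend (Subtype.val : σ → V) p 0

variable (n X) in
/-- A smooth triangulation of `X` with vertex set `V`: a simplicial complex with a locally finite
bijective parametrization of `X` by its geometric realization, which is a smooth embedding on each
closed simplex. -/
structure SmoothTriangulation (V : Type*) where
  complex : AbstractSimplicialComplex V
  /-- the parametrization of the closed simplex `σ` by barycentric coordinates -/
  param : (σ : Finset V) → (σ → ℝ) → X
  smooth : ∀ σ ∈ complex,
    ContMDiffOn 𝓘(ℝ, σ → ℝ) (𝓡 n) ∞ (param σ) (stdSimplex ℝ σ)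
  immersive : ∀ σ ∈ complex, ∀ p ∈ stdSimplex ℝ σ,
    ∀ L : TangentSpace 𝓘(ℝ, σ → ℝ) p →L[ℝ] TangentSpace (𝓡 n) (param σ p),
    HasMFDerivWithinAt 𝓘(ℝ, σ → ℝ) (𝓡 n) (param σ) (stdSimplex ℝ σ) p L →
    ∀ v : σ → ℝ, ∑ i, v i = 0 → L v = 0 → v = 0
  eq_iff : ∀ σ ∈ complex, ∀ τ ∈ complex, ∀ p ∈ stdSimplex ℝ σ, ∀ q ∈ stdSimplex ℝ τ,
    param σ p = param τ q ↔ extendCoord p = extendCoord q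
  covers : ∀ x : X, ∃ σ ∈ complex, ∃ p ∈ stdSimplex ℝ σ, param σ p = x
  locallyFinite : LocallyFinite
    (fun σ : {σ : Finset V // σ ∈ complex} => param σ.1 '' stdSimplex ℝ σ.1)

namespace SmoothTriangulation

variable {V : Type*} (T : SmoothTriangulation n X V)

/-- The closed simplex of `X` with vertex set `σ`. -/
def cell (σ : Finset V) : Set X := T.param σ '' stdSimplex ℝ σ

/-- A simplex containing `x`. -/
def carrier (x : X) : Finset V := (T.covers x).choose

/-- The barycentric coordinates of `x` in the simplex `T.carrier x`. -/
def coord (x : X) : T.carrier x → ℝ := (T.covers x).choose_spec.2.choose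

/-- The iterated folding map `s⁽ʳ⁾ : X → X`: in barycentric coordinates on each simplex it is the
`r`-th iterate of Thom's folding map. As Thom's folding map is hereditary, the choice of a
simplex containing `x` does not matter. -/
def fold (r : ℕ) (x : X) : X := T.param (T.carrier x) ((thomFold^[r]) (T.coord x))

end SmoothTriangulation

section Jiggle

variable [IsManifold (𝓡 n) ∞ X] {V : Type*}

/-- The triangulation is fine: for every point `x` of a simplex, the simplex is contained in
`exp_x (D_x X)`. -/
def IsFine (g : Metric n X) (ρ : X → ℝ) (T : SmoothTriangulation n X V) : Prop :=
  ∀ σ ∈ T.complex, ∀ x ∈ T.cell σ,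
    T.cell σ ⊆ (fun v : TangentSpace (𝓡 n) x => expMap g ⟨x, v⟩) '' disc g ρ x

/-- The `r`-th jiggling section `j⁽ʳ⁾(x) = exp_x⁻¹ (s⁽ʳ⁾(x)) ∈ D_x X`. -/
def jiggling (g : Metric n X) (ρ : X → ℝ) (T : SmoothTriangulation n X V) (r : ℕ) (x : X) :
    TangentBundle (𝓡 n) X :=
  ⟨x, Function.invFunOn (fun v : TangentSpace (𝓡 n) x => expMap g ⟨x, v⟩) (disc g ρ x)
    (T.fold r x)⟩

/-- The tangent vectors at `f p` to the image of the simplex `τ` under a map `f` to `TX` which is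
smooth on `τ`. -/
def tangentVectors {ι : Type*} [Fintype ι] (f : (ι → ℝ) → TangentBundle (𝓡 n) X)
    (τ : Set (ι → ℝ)) (p : ι → ℝ) : Set (TangentSpace (𝓡 n).tangent (f p)) :=
  {z | ∃ L : TangentSpace 𝓘(ℝ, ι → ℝ) p →L[ℝ] TangentSpace (𝓡 n).tangent (f p),
    HasMFDerivWithinAt 𝓘(ℝ, ι → ℝ) (𝓡 n).tangent f τ p L ∧
    ∃ v ∈ vectorSpan ℝ τ, L v = z}

/-- The section `j` of `TX` is quasi-transverse to the plane field `P`, relative to the `r`-th Thom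
subdivision of `T`: for each simplex `τ` of it, no nonzero tangent vector to `j τ` lies in `P`. -/
def IsQuasiTransverse (T : SmoothTriangulation n X V) (r : ℕ) (j : X → TangentBundle (𝓡 n) X)
    (P : (w : TangentBundle (𝓡 n) X) → Submodule ℝ (TangentSpace (𝓡 n).tangent w)) : Prop :=
  ∀ σ ∈ T.complex, ∀ τ ∈ iteratedThomSubdivision σ r, ∀ p ∈ τ,
    ∀ z ∈ tangentVectors (j ∘ T.param σ) τ p, z ∈ P (j (T.param σ p)) → z = 0

/-- A family of `n`-plane fields on the open set `D ⊆ TX`, jointly continuous in the parameter and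
the point: locally it is spanned by `n` continuous vector fields depending continuously on the
parameter; and each plane is `n`-dimensional and transverse to the fibres of `TX`. -/
structure IsTransversePlaneFamily {A : Type*} [TopologicalSpace A]
    (D : Set (TangentBundle (𝓡 n) X))
    (P : A → (w : TangentBundle (𝓡 n) X) → Submodule ℝ (TangentSpace (𝓡 n).tangent w)) :
    Prop where
  continuous : ∀ a, ∀ w ∈ D, ∃ U ∈ 𝓝 (a, w),
    ∃ e : Fin n → (q : A × TangentBundle (𝓡 n) X) → TangentSpace (𝓡 n).tangent q.2,
      (∀ i, ContinuousOn (fun q : A × TangentBundle (𝓡 n) X =>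
        (⟨q.2, e i q⟩ : TangentBundle (𝓡 n).tangent (TangentBundle (𝓡 n) X))) U) ∧
      ∀ q ∈ U, P q.1 q.2 = Submodule.span ℝ (range fun i => e i q)
  finrank : ∀ a, ∀ w ∈ D, Module.finrank ℝ (P a w) = n
  transverse : ∀ a, ∀ w ∈ D, IsCompl (P a w) (verticalSpace w)

end Jiggle

end Jiggling

end

/-! Let φ be the parametrization of a simplex σ of the triangulation, and let τ be a simplex of the
r-th subdivision of σ. On τ the iterated folding is the inverse of an invertible linear map M
(`IsCellParam`, `exists_isCellParam`). Since π ∘ j is the identity and exp ∘ j is the folding map, a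
tangent vector z to j(τ) that comes from a vector v satisfies dπ(z) = dφ(v) and dexp(z) = dφ(M⁻¹v)
(`IsCellParam.exists_of_mem_tangentVectors`). Everything then rests on two properties of M.

First, M is injective and φ is immersive, so dexp(z) = 0 forces z = 0. This is quasi-transversality
to the exponential foliation, and it holds for every r.

Second, M shrinks the ℓ¹ norm of vectors of sum zero by κ^r with κ < 1
(`sum_abs_subdivisionMap_le`). By compactness of the simplex, φ distorts lengths by a bounded factor
(`exists_length_param_bounds`), so |dπ(z)| is at most a constant times κ^r |dexp(z)|
(`exists_forall_length_le`). A plane transverse to the fibres satisfies an opposite inequality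
|dexp(z)| ≤ C |dπ(z)|, uniformly over a compact set of points and parameters
(`IsTransversePlaneFamily.exists_bound`). For large r the two together force dπ(z) = 0, hence z = 0
by transversality. Compactness of X leaves finitely many simplices to treat.

All this presupposes that the chromatic simplices do cover the standard simplex and that folding is
well defined. Both follow by attaching to each point x a height function c, characterized by x alone
(`IsHeight`), whose superlevel sets recover the relevant sets S_i. Heights exist (`exists_isHeight`)
and are unique (`IsHeight.unique`).

Regularity of j comes from the inverse function theorem applied to (π, exp) : DX → X × X, whose
differential is injective between spaces of equal dimension (`IsAdmissible.contMDiffAt_expInv`). -/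

noncomputable section

namespace Jiggling

/-! ### Heights: the chromatic simplices cover the simplex, and folding is well defined -/

section Subdivision

variable {ι : Type*}

lemma two_mul_card_sub_one_pos {i : ι} {S : Finset ι} (h : i ∈ S) :
    0 < 2 * (S.card : ℝ) - 1 := by
  have : (1 : ℝ) ≤ S.card := by exact_mod_cast Finset.card_pos.2 ⟨i, h⟩
  linarith

lemma chromaticVertex_nonneg {i : ι} {S : Finset ι} (h : i ∈ S) (j : ι) :
    0 ≤ chromaticVertex i S j := by
  have := two_mul_card_sub_one_pos h
  unfold chromaticVertex
  split_ifs <;> positivity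

/-- The weights in terms of which the map `subdivisionMap` has integral coefficients. -/
def snapshotWeight (S : ι → Finset ι) (t : ι → ℝ) (i : ι) : ℝ :=
  t i / (2 * ((S i).card : ℝ) - 1)

lemma snapshotWeight_nonneg {S : ι → Finset ι} (hS : IsSnapshot S) {t : ι → ℝ}
    (ht : ∀ i, 0 ≤ t i) (i : ι) : 0 ≤ snapshotWeight S t i :=
  div_nonneg (ht i) (two_mul_card_sub_one_pos (hS.self_mem i)).le

-- Heights are built level by level from the bottom. The number A is the total of c − x over the
-- levels already placed, and R is the set of indices still to be placed.
open Classical in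
lemma exists_height_on (x : ι → ℝ) (R : Finset ι) : ∀ A : ℝ, (∀ i ∈ R, 2 * A ≤ x i) →
    ∃ c : ι → ℝ, (∀ i ∈ R, x i ≤ c i) ∧
      ∀ j ∈ R, c j = 2 * A + 2 * ∑ i ∈ R with c i ≤ c j, (c i - x i) := by
  induction R using Finset.strongInduction with
  | H R ih =>
    intro A hA
    rcases R.eq_empty_or_nonempty with rfl | hR
    · exact ⟨x, by simp, by simp⟩
    obtain ⟨k, hk, hmin⟩ := Finset.exists_min_image R x hR
    -- The next level θ must solve θ = 2A + 2 ∑ (θ − x i)⁺. The difference of the two sides is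
    -- nonnegative at the minimum x k and nonpositive at 2 x k − 2A, where the term of k alone
    -- suffices.
    have hcont : Continuous fun θ : ℝ => θ - 2 * A - 2 * ∑ i ∈ R, max (θ - x i) 0 := by fun_prop
    obtain ⟨θ, hθ, hθ0⟩ : ∃ θ ∈ Icc (x k) (2 * x k - 2 * A),
        θ - 2 * A - 2 * ∑ i ∈ R, max (θ - x i) 0 = 0 := by
      have hAk := hA k hk
      refine intermediate_value_Icc' (by linarith) hcont.continuousOn ⟨?_, ?_⟩
      · have : max (2 * x k - 2 * A - x k) 0 ≤ ∑ i ∈ R, max (2 * x k - 2 * A - x i) 0 :=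
          Finset.single_le_sum (f := fun i => max (2 * x k - 2 * A - x i) 0)
            (fun i _ => le_max_right _ _) hk
        have h' := le_max_left (2 * x k - 2 * A - x k) 0
        linarith
      · have : ∑ i ∈ R, max (x k - x i) 0 = 0 :=
          Finset.sum_eq_zero fun i hi => max_eq_right (by linarith [hmin i hi])
        simp only [this]
        linarith
    have hsum : ∑ i ∈ R, max (θ - x i) 0 = ∑ i ∈ R with x i ≤ θ, (θ - x i) := by
      rw [Finset.sum_filter]
      refine Finset.sum_congr rfl fun i _ => ?_
      split_ifs with h
      · exact max_eq_left (by linarith)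
      · exact max_eq_right (by linarith [not_le.1 h])
    rw [hsum] at hθ0
    -- All indices with x i ≤ θ receive height θ. By the equation for θ, the new accumulated total
    -- is exactly θ / 2.
    obtain ⟨c, hc, hc'⟩ := ih (R.filter fun i => ¬ x i ≤ θ)
      (Finset.filter_ssubset.2 ⟨k, hk, by simpa using hθ.1⟩) (θ / 2)
      (fun i hi => by
        have := (Finset.mem_filter.1 hi).2
        linarith)
    have hlt : ∀ i ∈ R, ¬ x i ≤ θ → θ < c i := fun i hi h =>
      (not_le.1 h).trans_le (hc i (Finset.mem_filter.2 ⟨hi, h⟩))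
    refine ⟨fun i => if x i ≤ θ then θ else c i, fun i hi => ?_, fun j hj => ?_⟩
    · dsimp only
      split_ifs with h
      · exact h
      · exact hc i (Finset.mem_filter.2 ⟨hi, h⟩)
    · by_cases h : x j ≤ θ
      · simp only [h, if_true]
        have : ∑ i ∈ R with (if x i ≤ θ then θ else c i) ≤ θ,
            ((if x i ≤ θ then θ else c i) - x i) = ∑ i ∈ R with x i ≤ θ, (θ - x i) := by
          rw [Finset.sum_filter, Finset.sum_filter]
          refine Finset.sum_congr rfl fun i hi => ?_
          by_cases hi' : x i ≤ θ
          · simp [hi']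
          · simp [hi', hlt i hi hi']
        rw [this]
        linarith
      · have hj' := hc' j (Finset.mem_filter.2 ⟨hj, h⟩)
        simp only [h, if_false]
        have : ∑ i ∈ R with (if x i ≤ θ then θ else c i) ≤ c j,
            ((if x i ≤ θ then θ else c i) - x i) = ∑ i ∈ R with x i ≤ θ, (θ - x i) +
              ∑ i ∈ (R.filter fun i => ¬ x i ≤ θ) with c i ≤ c j, (c i - x i) := by
          rw [Finset.filter_filter, Finset.sum_filter, Finset.sum_filter, Finset.sum_filter,
            ← Finset.sum_add_distrib]
          refine Finset.sum_congr rfl fun i hi => ?_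
          by_cases hi' : x i ≤ θ
          · simp [hi', (hlt j hj h).le]
          · simp [hi']
        rw [this]
        linarith

variable [Fintype ι]

/-- The linear map sending the vertex `i` of the standard simplex to the vertex `(i, S i)` of the
chromatic subdivision. -/
def subdivisionMap (S : ι → Finset ι) : (ι → ℝ) →ₗ[ℝ] (ι → ℝ) :=
  ∑ i, (LinearMap.proj i : (ι → ℝ) →ₗ[ℝ] ℝ).smulRight (chromaticVertex i (S i))

lemma subdivisionMap_apply (S : ι → Finset ι) (t : ι → ℝ) :
    subdivisionMap S t = ∑ i, t i • chromaticVertex i (S i) := by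
  simp [subdivisionMap, LinearMap.sum_apply]

lemma inv_le_chromaticVertex {i j : ι} {S : Finset ι} (h : i ∈ S) (hj : j ∈ S) :
    1 / (2 * (Fintype.card ι : ℝ) - 1) ≤ chromaticVertex i S j := by
  have h₁ := two_mul_card_sub_one_pos h
  have h₂ : (S.card : ℝ) ≤ Fintype.card ι := by exact_mod_cast Finset.card_le_univ S
  have h₃ : 1 / (2 * (Fintype.card ι : ℝ) - 1) ≤ 1 / (2 * (S.card : ℝ) - 1) :=
    one_div_le_one_div_of_le h₁ (by linarith)
  refine h₃.trans ?_
  unfold chromaticVertex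
  rw [if_pos hj]
  gcongr
  split_ifs <;> norm_num

lemma sum_chromaticVertex {i : ι} {S : Finset ι} (h : i ∈ S) :
    ∑ j, chromaticVertex i S j = 1 := by
  classical
  have h₁ := two_mul_card_sub_one_pos h
  have h₂ : ∀ j, chromaticVertex i S j =
      (if j ∈ S then 2 else 0) / (2 * (S.card : ℝ) - 1) -
        (if j = i then 1 else 0) / (2 * (S.card : ℝ) - 1) := by
    intro j
    unfold chromaticVertex
    by_cases hj : j ∈ S
    · by_cases hji : j = i
      · subst hji
        rw [if_pos hj, if_pos rfl, if_pos hj, if_pos rfl]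
        ring
      · simp [hj, hji]
    · have : j ≠ i := fun e => hj (e ▸ h)
      simp [hj, this]
  simp only [h₂, Finset.sum_sub_distrib, ← Finset.sum_div]
  rw [← sub_div]
  simp only [Finset.sum_ite_mem, Finset.univ_inter, Finset.sum_const, nsmul_eq_mul,
    Finset.sum_ite_eq', Finset.mem_univ, if_true]
  rw [mul_comm, div_self h₁.ne']

lemma sum_subdivisionMap {S : ι → Finset ι} (hS : IsSnapshot S) (t : ι → ℝ) :
    ∑ j, subdivisionMap S t j = ∑ i, t i := by
  simp only [subdivisionMap_apply, Finset.sum_apply, Pi.smul_apply, smul_eq_mul]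
  rw [Finset.sum_comm]
  simp only [← Finset.mul_sum, sum_chromaticVertex (hS.self_mem _), mul_one]

lemma subdivisionMap_mem_stdSimplex {S : ι → Finset ι} (hS : IsSnapshot S) {t : ι → ℝ}
    (ht : t ∈ stdSimplex ℝ ι) : subdivisionMap S t ∈ stdSimplex ℝ ι := by
  refine ⟨fun j => ?_, (sum_subdivisionMap hS t).trans ht.2⟩
  simp only [subdivisionMap_apply, Finset.sum_apply, Pi.smul_apply, smul_eq_mul]
  exact Finset.sum_nonneg fun i _ =>
    mul_nonneg (ht.1 i) (chromaticVertex_nonneg (hS.self_mem i) j)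

-- Up to the factor 2|S| − 1, the vertex (i, S) is twice the indicator of S minus the i-th basis
-- vector.
open Classical in
lemma subdivisionMap_apply_eq {S : ι → Finset ι} (hS : IsSnapshot S) (t : ι → ℝ) (j : ι) :
    subdivisionMap S t j =
      2 * ∑ i with j ∈ S i, snapshotWeight S t i - snapshotWeight S t j := by
  have h : ∀ i, t i * chromaticVertex i (S i) j =
      2 * (if j ∈ S i then snapshotWeight S t i else 0) -
        (if j = i then snapshotWeight S t i else 0) := by
    intro i
    unfold chromaticVertex snapshotWeight
    by_cases hji : j = i
    · subst hji
      simp only [hS.self_mem j, if_true]; ring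
    · by_cases hj : j ∈ S i
      · simp only [hj, hji, if_true, if_false]; ring
      · simp [hj, hji]
  simp only [subdivisionMap_apply, Finset.sum_apply, Pi.smul_apply, smul_eq_mul, h,
    Finset.sum_sub_distrib, ← Finset.mul_sum]
  rw [Finset.sum_ite_eq, if_pos (Finset.mem_univ j), Finset.sum_filter]

open Classical in
/-- A height function for the point `x`; heights are a substitute, depending on the point only, for
the simplices of the chromatic subdivision containing it. -/
structure IsHeight (x c : ι → ℝ) : Prop where
  le : ∀ i, x i ≤ c i
  eq : ∀ j, c j = 2 * ∑ i with c i ≤ c j, (c i - x i)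

/-- Let k maximize d on the level of j for c. Minimality of j gives {c ≤ c j} ⊆ {d ≤ d k}, and c ≤ d
on the smaller set. Comparing the two height equations yields d k ≥ c k + 2 (d k − c k), which the
factor 2 makes incompatible with c k < d k. -/
lemma IsHeight.not_lt_of_minimal {x c d : ι → ℝ} (hc : IsHeight x c) (hd : IsHeight x d) (j : ι)
    (hj : c j < d j) (hmin : ∀ i, c i ≠ d i → c j ≤ c i ∧ c j ≤ d i) : False := by
  classical
  obtain ⟨k, hk, hkmax⟩ := Finset.exists_max_image (Finset.univ.filter fun i => c i = c j) d
    ⟨j, by simp⟩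
  simp only [Finset.mem_filter, Finset.mem_univ, true_and] at hk hkmax
  have hjk : d j ≤ d k := hkmax j rfl
  have hle : ∀ i, c i ≤ c j → d i ≤ d k := by
    intro i hi
    by_cases h : c i = c j
    · exact hkmax i h
    · have : c i = d i := by
        by_contra h'
        exact h (le_antisymm hi (hmin i h').1)
      linarith
  have hge : ∀ i, c i ≤ c j → c i ≤ d i := by
    intro i hi
    by_cases h : c i = d i
    · exact h.le
    · exact hi.trans (hmin i h).2
  have h₁ : ∑ i with c i ≤ c j, (d i - x i) ≤ ∑ i with d i ≤ d k, (d i - x i) := by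
    refine Finset.sum_le_sum_of_subset_of_nonneg ?_ fun i _ _ => sub_nonneg.2 (hd.le i)
    intro i
    simpa using hle i
  have h₂ : ∑ i with c i ≤ c j, (c i - x i) + (d k - c k) ≤
      ∑ i with c i ≤ c j, (d i - x i) := by
    have : d k - c k ≤ ∑ i with c i ≤ c j, (d i - c i) :=
      Finset.single_le_sum (f := fun i => d i - c i)
        (fun i hi => sub_nonneg.2 (hge i (by simpa using hi))) (by simp [hk])
    have e : ∑ i with c i ≤ c j, (d i - x i) = ∑ i with c i ≤ c j, (c i - x i) +
        ∑ i with c i ≤ c j, (d i - c i) := by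
      rw [← Finset.sum_add_distrib]
      exact Finset.sum_congr rfl fun i _ => by ring
    linarith
  have h₃ := hc.eq j
  have h₄ := hd.eq k
  linarith

lemma IsHeight.unique {x c d : ι → ℝ} (hc : IsHeight x c) (hd : IsHeight x d) : c = d := by
  classical
  by_contra hne
  obtain ⟨i₀, hi₀⟩ := Function.ne_iff.1 hne
  obtain ⟨j, hj, hmin⟩ := Finset.exists_min_image (Finset.univ.filter fun i => c i ≠ d i)
    (fun i => min (c i) (d i)) ⟨i₀, by simpa using hi₀⟩
  simp only [Finset.mem_filter, Finset.mem_univ, true_and] at hj hmin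
  rcases lt_or_gt_of_ne hj with h | h
  · refine hc.not_lt_of_minimal hd j h fun i hi => ?_
    have := hmin i hi
    rw [min_eq_left h.le] at this
    exact le_min_iff.1 this
  · refine hd.not_lt_of_minimal hc j h fun i hi => ?_
    have := hmin i hi.symm
    rw [min_eq_right h.le] at this
    exact (le_min_iff.1 this).symm

/-- The height function of the point `subdivisionMap S t`. -/
def snapshotHeight (S : ι → Finset ι) (t : ι → ℝ) (j : ι) : ℝ :=
  subdivisionMap S t j + snapshotWeight S t j

open Classical in
lemma snapshotHeight_eq {S : ι → Finset ι} (hS : IsSnapshot S) (t : ι → ℝ) (j : ι) :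
    snapshotHeight S t j = 2 * ∑ i with j ∈ S i, snapshotWeight S t i := by
  rw [snapshotHeight, subdivisionMap_apply_eq hS]; ring

/-- The height at j is twice the total weight of the sets containing j. By immediacy, j ∈ S i makes
every set containing i contain j; otherwise the chain condition gives i ∈ S j, and the positive
weight of S i makes the comparison strict. -/
lemma mem_snapshot_iff_height {S : ι → Finset ι} (hS : IsSnapshot S) {t : ι → ℝ}
    (ht : ∀ i, 0 ≤ t i) {i : ι} (hi : snapshotWeight S t i ≠ 0) (j : ι) :
    j ∈ S i ↔ snapshotHeight S t i ≤ snapshotHeight S t j := by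
  classical
  have ha := snapshotWeight_nonneg hS ht
  rw [snapshotHeight_eq hS, snapshotHeight_eq hS]
  constructor
  · intro hj
    refine mul_le_mul_of_nonneg_left (Finset.sum_le_sum_of_subset_of_nonneg ?_
      fun k _ _ => ha k) zero_le_two
    intro k
    simp only [Finset.mem_filter, Finset.mem_univ, true_and]
    exact fun hk => hS.immediate _ _ hk hj
  · intro h
    by_contra hj
    have hij : i ∈ S j := ((hS.chain j i).resolve_left fun h' => hj (h' (hS.self_mem j)))
      (hS.self_mem i)
    have hlt : ∑ k with j ∈ S k, snapshotWeight S t k < ∑ k with i ∈ S k, snapshotWeight S t k := by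
      refine Finset.sum_lt_sum_of_subset (i := i) ?_ (by simp [hS.self_mem]) (by simpa using hj)
        (lt_of_le_of_ne (ha i) hi.symm) fun k _ _ => ha k
      intro k
      simp only [Finset.mem_filter, Finset.mem_univ, true_and]
      exact fun hk => hS.immediate _ _ hk hij
    linarith

lemma isHeight_snapshotHeight {S : ι → Finset ι} (hS : IsSnapshot S) {t : ι → ℝ}
    (ht : ∀ i, 0 ≤ t i) : IsHeight (subdivisionMap S t) (snapshotHeight S t) := by
  classical
  refine ⟨fun i => by simpa [snapshotHeight] using snapshotWeight_nonneg hS ht i, fun j => ?_⟩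
  refine (snapshotHeight_eq hS t j).trans ?_
  rw [Finset.sum_filter, Finset.sum_filter]
  congr 1
  refine Finset.sum_congr rfl fun i _ => ?_
  have e : snapshotHeight S t i - subdivisionMap S t i = snapshotWeight S t i := by
    simp [snapshotHeight]
  rw [e]
  by_cases hi : snapshotWeight S t i = 0
  · simp [hi]
  · simp only [mem_snapshot_iff_height hS ht hi]

/-- The simplices of the chromatic subdivision have disjoint interiors. -/
lemma eq_of_subdivisionMap_eq {S S' : ι → Finset ι} (hS : IsSnapshot S) (hS' : IsSnapshot S')
    {t t' : ι → ℝ} (ht : ∀ i, 0 ≤ t i) (ht' : ∀ i, 0 ≤ t' i)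
    (h : subdivisionMap S t = subdivisionMap S' t') : t = t' := by
  have hc : snapshotHeight S t = snapshotHeight S' t' :=
    (isHeight_snapshotHeight hS ht).unique (h ▸ isHeight_snapshotHeight hS' ht')
  funext i
  have ha : snapshotWeight S t i = snapshotWeight S' t' i := by
    have := congrFun hc i
    simpa [snapshotHeight, h] using this
  have e := two_mul_card_sub_one_pos (hS.self_mem i)
  have e' := two_mul_card_sub_one_pos (hS'.self_mem i)
  by_cases hi : snapshotWeight S t i = 0
  · have hi' := ha ▸ hi
    rw [snapshotWeight, div_eq_zero_iff] at hi hi'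
    rw [hi.resolve_right e.ne', hi'.resolve_right e'.ne']
  -- A set of nonzero weight is a superlevel set of the common height, so the two denominators
  -- agree. For zero weight the sets may differ, but both coefficients vanish.
  · have hSS : S i = S' i := by
      ext j
      rw [mem_snapshot_iff_height hS ht hi, mem_snapshot_iff_height hS' ht' (ha ▸ hi), hc]
    rw [snapshotWeight, snapshotWeight, ← hSS] at ha
    exact (div_left_inj' e.ne').1 ha

lemma exists_isHeight {x : ι → ℝ} (hx : ∀ i, 0 ≤ x i) : ∃ c, IsHeight x c := by
  classical
  obtain ⟨c, hc, hc'⟩ := exists_height_on x Finset.univ 0 (by simpa using hx)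
  exact ⟨c, fun i => hc i (Finset.mem_univ i), fun j => by simpa using hc' j (Finset.mem_univ j)⟩

/-- The simplices of the chromatic subdivision cover the standard simplex. -/
lemma exists_subdivisionMap_eq {x : ι → ℝ} (hx : x ∈ stdSimplex ℝ ι) :
    ∃ t ∈ stdSimplex ℝ ι, ∃ S : ι → Finset ι, IsSnapshot S ∧ x = subdivisionMap S t := by
  classical
  obtain ⟨c, hc⟩ := exists_isHeight hx.1
  -- Superlevel sets of any function form a snapshot, and the height equation says exactly that the
  -- weights c − x reproduce x.
  set S : ι → Finset ι := fun i => Finset.univ.filter fun j => c i ≤ c j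
  have hS : IsSnapshot S := by
    refine ⟨fun i => by simp [S], fun i j => ?_, fun i j hj k => ?_⟩
    · rcases le_total (c i) (c j) with h | h
      · right; intro k; simpa [S] using h.trans
      · left; intro k; simpa [S] using h.trans
    · have : c i ≤ c j := by simpa [S] using hj
      simpa [S] using this.trans
  set t : ι → ℝ := fun i => (c i - x i) * (2 * ((S i).card : ℝ) - 1)
  have hw : ∀ i, snapshotWeight S t i = c i - x i := fun i =>
    mul_div_cancel_right₀ _ (two_mul_card_sub_one_pos (hS.self_mem i)).ne'
  have hxt : x = subdivisionMap S t := by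
    funext j
    rw [subdivisionMap_apply_eq hS]
    simp only [hw]
    have := hc.eq j
    have e : (Finset.univ.filter fun i => j ∈ S i) = Finset.univ.filter fun i => c i ≤ c j := by
      ext i; simp [S]
    rw [e]
    linarith
  refine ⟨t, ⟨fun i => mul_nonneg (sub_nonneg.2 (hc.le i))
    (two_mul_card_sub_one_pos (hS.self_mem i)).le, ?_⟩, S, hS, hxt⟩
  rw [← sum_subdivisionMap hS, ← hxt, hx.2]

/-- The folding map inverts the parametrizations of the simplices of the subdivision. -/
lemma thomFold_subdivisionMap {S : ι → Finset ι} (hS : IsSnapshot S) {t : ι → ℝ}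
    (ht : t ∈ stdSimplex ℝ ι) : thomFold (subdivisionMap S t) = t := by
  have h : ∃ t' ∈ stdSimplex ℝ ι, ∃ S' : ι → Finset ι, IsSnapshot S' ∧
      subdivisionMap S t = ∑ i, t' i • chromaticVertex i (S' i) :=
    ⟨t, ht, S, hS, subdivisionMap_apply S t⟩
  rw [thomFold, dif_pos h]
  obtain ⟨h₁, S', hS', h₂⟩ := h.choose_spec
  rw [← subdivisionMap_apply] at h₂
  exact (eq_of_subdivisionMap_eq hS hS' ht.1 h₁.1 h₂).symm

lemma thomFold_mem_stdSimplex {x : ι → ℝ} (hx : x ∈ stdSimplex ℝ ι) :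
    thomFold x ∈ stdSimplex ℝ ι := by
  obtain ⟨t, ht, S, hS, rfl⟩ := exists_subdivisionMap_eq hx
  rwa [thomFold_subdivisionMap hS ht]

lemma iterate_thomFold_mem_stdSimplex {x : ι → ℝ} (hx : x ∈ stdSimplex ℝ ι) (r : ℕ) :
    thomFold^[r] x ∈ stdSimplex ℝ ι := by
  induction r with
  | zero => exact hx
  | succ r ih => rw [Function.iterate_succ_apply']; exact thomFold_mem_stdSimplex ih

end Subdivision

/-! ### Compatibility of folding with faces -/

section Heredity

variable {ι κ : Type*} [Fintype ι] [Fintype κ]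

lemma extend_mem_stdSimplex {f : ι → κ} (hf : Function.Injective f) {t : ι → ℝ}
    (ht : t ∈ stdSimplex ℝ ι) : Function.extend f t 0 ∈ stdSimplex ℝ κ := by
  refine ⟨fun k => ?_, ?_⟩
  · by_cases hk : ∃ i, f i = k
    · obtain ⟨i, rfl⟩ := hk
      rw [hf.extend_apply]
      exact ht.1 i
    · rw [Function.extend_apply' _ _ _ hk]
      rfl
  · rw [← ht.2]
    exact (Fintype.sum_of_injective f hf t (Function.extend f t 0)
      (fun k hk => Function.extend_apply' _ _ _ hk) fun i => (hf.extend_apply _ _ i).symm).symm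

/-- The folding map is compatible with passing to faces. -/
lemma thomFold_extend {f : ι → κ} (hf : Function.Injective f) {x : ι → ℝ}
    (hx : x ∈ stdSimplex ℝ ι) :
    thomFold (Function.extend f x 0) = Function.extend f (thomFold x) 0 := by
  classical
  obtain ⟨t, ht, S, hS, rfl⟩ := exists_subdivisionMap_eq hx
  rw [thomFold_subdivisionMap hS ht]
  -- The new vertices carry zero coefficients; giving them the full set preserves the chain and
  -- immediacy conditions.
  set S' : κ → Finset κ := Function.extend f (fun i => (S i).map ⟨f, hf⟩) fun _ => Finset.univ
  have h₁ : ∀ i, S' (f i) = (S i).map ⟨f, hf⟩ := fun i => hf.extend_apply _ _ i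
  have h₂ : ∀ k, (¬ ∃ i, f i = k) → S' k = Finset.univ := fun k hk =>
    Function.extend_apply' _ _ _ hk
  have hS' : IsSnapshot S' := by
    refine ⟨fun k => ?_, fun k l => ?_, fun k l hl => ?_⟩
    · by_cases hk : ∃ i, f i = k
      · obtain ⟨i, rfl⟩ := hk
        rw [h₁]
        exact Finset.mem_map_of_mem _ (hS.self_mem i)
      · simp [h₂ k hk]
    · by_cases hk : ∃ i, f i = k
      · by_cases hl : ∃ i, f i = l
        · obtain ⟨i, rfl⟩ := hk
          obtain ⟨j, rfl⟩ := hl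
          rw [h₁, h₁, Finset.map_subset_map, Finset.map_subset_map]
          exact hS.chain i j
        · left; simp [h₂ l hl]
      · right; simp [h₂ k hk]
    · by_cases hk : ∃ i, f i = k
      · obtain ⟨i, rfl⟩ := hk
        rw [h₁] at hl ⊢
        obtain ⟨j, hj, rfl⟩ := Finset.mem_map.1 hl
        rw [Function.Embedding.coeFn_mk, h₁, Finset.map_subset_map]
        exact hS.immediate i j hj
      · simp [h₂ k hk]
  have hv : ∀ i j, chromaticVertex (f i) (S' (f i)) (f j) = chromaticVertex i (S i) j := by
    intro i j
    have : f j ∈ (S i).map ⟨f, hf⟩ ↔ j ∈ S i := Finset.mem_map' ⟨f, hf⟩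
    rw [h₁]
    simp only [chromaticVertex, Finset.card_map, this, hf.eq_iff]
  have hext : Function.extend f (subdivisionMap S t) 0 =
      subdivisionMap S' (Function.extend f t 0) := by
    funext k
    simp only [subdivisionMap_apply, Finset.sum_apply, Pi.smul_apply, smul_eq_mul]
    rw [← Fintype.sum_of_injective f hf (fun i => t i * chromaticVertex (f i) (S' (f i)) k) _
      (fun l hl => by rw [Function.extend_apply' _ _ _ hl, Pi.zero_apply, zero_mul])
      (fun i => by rw [hf.extend_apply])]
    by_cases hk : ∃ j, f j = k
    · obtain ⟨j, rfl⟩ := hk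
      rw [hf.extend_apply, Finset.sum_apply]
      simp only [hv, Pi.smul_apply, smul_eq_mul]
    · rw [Function.extend_apply' _ _ _ hk, Pi.zero_apply]
      refine (Finset.sum_eq_zero fun i _ => ?_).symm
      have : k ∉ S' (f i) := by
        rw [h₁]
        intro h
        obtain ⟨j, -, hj⟩ := Finset.mem_map.1 h
        exact hk ⟨j, hj⟩
      simp [chromaticVertex, this]
  rw [hext, thomFold_subdivisionMap hS' (extend_mem_stdSimplex hf ht)]

lemma iterate_thomFold_extend {f : ι → κ} (hf : Function.Injective f) {x : ι → ℝ}
    (hx : x ∈ stdSimplex ℝ ι) (r : ℕ) :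
    thomFold^[r] (Function.extend f x 0) = Function.extend f (thomFold^[r] x) 0 := by
  induction r with
  | zero => rfl
  | succ r ih =>
    rw [Function.iterate_succ_apply', ih, thomFold_extend hf (iterate_thomFold_mem_stdSimplex hx r),
      Function.iterate_succ_apply']

end Heredity

/-- Both points are compared in the simplex spanned by σ ∪ τ, which need not belong to the complex.
This makes the folding of X independent of the chosen carrier. -/
lemma extendCoord_iterate_thomFold_eq {V : Type*} {σ τ : Finset V} {p : σ → ℝ} {q : τ → ℝ}
    (hp : p ∈ stdSimplex ℝ σ) (hq : q ∈ stdSimplex ℝ τ) (h : extendCoord p = extendCoord q)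
    (r : ℕ) : extendCoord (thomFold^[r] p) = extendCoord (thomFold^[r] q) := by
  classical
  set f : σ → ↥(σ ∪ τ) := fun i => ⟨i, Finset.mem_union_left _ i.2⟩
  set g : τ → ↥(σ ∪ τ) := fun i => ⟨i, Finset.mem_union_right _ i.2⟩
  have hf : Function.Injective f := fun i j hij =>
    Subtype.ext (congrArg (fun k : ↥(σ ∪ τ) => (k : V)) hij)
  have hg : Function.Injective g := fun i j hij =>
    Subtype.ext (congrArg (fun k : ↥(σ ∪ τ) => (k : V)) hij)
  have ef : ∀ (u : σ → ℝ) (k : ↥(σ ∪ τ)), Function.extend f u 0 k = extendCoord u k := by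
    intro u k
    by_cases hk : ∃ i, f i = k
    · obtain ⟨i, rfl⟩ := hk
      rw [hf.extend_apply]
      exact (Subtype.val_injective.extend_apply u 0 i).symm
    · rw [Function.extend_apply' _ _ _ hk, extendCoord, Function.extend_apply']
      · rfl
      · rintro ⟨i, hi⟩
        exact hk ⟨i, Subtype.ext hi⟩
  have eg : ∀ (u : τ → ℝ) (k : ↥(σ ∪ τ)), Function.extend g u 0 k = extendCoord u k := by
    intro u k
    by_cases hk : ∃ i, g i = k
    · obtain ⟨i, rfl⟩ := hk
      rw [hg.extend_apply]
      exact (Subtype.val_injective.extend_apply u 0 i).symm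
    · rw [Function.extend_apply' _ _ _ hk, extendCoord, Function.extend_apply']
      · rfl
      · rintro ⟨i, hi⟩
        exact hk ⟨i, Subtype.ext hi⟩
  have hfg : Function.extend f p 0 = Function.extend g q 0 := by
    funext k
    rw [ef, eg, h]
  have key : Function.extend f (thomFold^[r] p) 0 = Function.extend g (thomFold^[r] q) 0 := by
    rw [← iterate_thomFold_extend hf hp, ← iterate_thomFold_extend hg hq, hfg]
  funext k
  by_cases hk : k ∈ σ ∪ τ
  · rw [← ef _ ⟨k, hk⟩, ← eg _ ⟨k, hk⟩, key]
  · rw [Finset.mem_union, not_or] at hk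
    rw [extendCoord, extendCoord, Function.extend_apply', Function.extend_apply']
    · rintro ⟨i, rfl⟩
      exact hk.2 i.2
    · rintro ⟨i, rfl⟩
      exact hk.1 i.2

/-- A function whose composition with a continuous parametrization of a compact set is continuous
is continuous on this set. -/
lemma _root_.IsCompact.continuousOn_image_of_comp {A B C : Type*} [TopologicalSpace A]
    [TopologicalSpace B] [TopologicalSpace C] [T2Space B] {K : Set A} (hK : IsCompact K)
    {φ : A → B} (hφ : ContinuousOn φ K) {h : B → C} (hh : ContinuousOn (h ∘ φ) K) :
    ContinuousOn h (φ '' K) := by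
  rw [continuousOn_iff_isClosed]
  intro F hF
  obtain ⟨u, hu, hu'⟩ := continuousOn_iff_isClosed.1 hh F hF
  refine ⟨φ '' (u ∩ K), ((hK.inter_left hu).image_of_continuousOn
    (hφ.mono inter_subset_right)).isClosed, ?_⟩
  rw [← hu']
  ext y
  constructor
  · rintro ⟨hy, x, hx, rfl⟩
    exact ⟨⟨x, ⟨hy, hx⟩, rfl⟩, x, hx, rfl⟩
  · rintro ⟨⟨x, ⟨hx, hxK⟩, rfl⟩, -⟩
    exact ⟨hx, x, hxK, rfl⟩

/-! ### Linear parametrizations of the cells and their contraction -/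

section Cells

variable {ι : Type*}

/-- The face of the standard simplex spanned by `J`. -/
def stdFace (J : Finset ι) : Set (ι → ℝ) :=
  open Classical in convexHull ℝ ((fun i => (Pi.single i 1 : ι → ℝ)) '' (J : Set ι))

lemma convex_stdFace (J : Finset ι) : Convex ℝ (stdFace J) := convex_convexHull _ _

variable [Fintype ι]

lemma continuousOn_thomFold : ContinuousOn (thomFold : (ι → ℝ) → ι → ℝ) (stdSimplex ℝ ι) := by
  have hcont : ∀ S : ι → Finset ι, Continuous (subdivisionMap S) := fun S =>
    (subdivisionMap S).continuous_of_finiteDimensional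
  have hcell : ∀ S : {S : ι → Finset ι // IsSnapshot S},
      ContinuousOn (thomFold : (ι → ℝ) → ι → ℝ) (subdivisionMap S.1 '' stdSimplex ℝ ι) := fun S =>
    (isCompact_stdSimplex ℝ ι).continuousOn_image_of_comp (hcont S).continuousOn
      (continuousOn_id.congr fun t ht => thomFold_subdivisionMap S.2 ht)
  have hfin : LocallyFinite fun S : {S : ι → Finset ι // IsSnapshot S} =>
      subdivisionMap S.1 '' stdSimplex ℝ ι := locallyFinite_of_finite _
  refine (hfin.continuousOn_iUnion (fun S =>
    ((isCompact_stdSimplex ℝ ι).image (hcont S.1)).isClosed) hcell).mono fun x hx => ?_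
  obtain ⟨t, ht, S, hS, rfl⟩ := exists_subdivisionMap_eq hx
  exact mem_iUnion.2 ⟨⟨S, hS⟩, t, ht, rfl⟩

lemma continuousOn_iterate_thomFold (r : ℕ) :
    ContinuousOn (thomFold^[r] : (ι → ℝ) → ι → ℝ) (stdSimplex ℝ ι) := by
  induction r with
  | zero => exact continuousOn_id
  | succ r ih =>
    rw [Function.iterate_succ']
    exact continuousOn_thomFold.comp ih fun x hx => iterate_thomFold_mem_stdSimplex hx r

/-- For a vector in the kernel, the positive and negative parts are nonnegative with equal images,
so `eq_of_subdivisionMap_eq` applies; it does not need coordinates of sum 1. -/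
lemma subdivisionMap_injective {S : ι → Finset ι} (hS : IsSnapshot S) :
    Function.Injective (subdivisionMap S) := by
  rw [← LinearMap.ker_eq_bot, LinearMap.ker_eq_bot']
  intro v hv
  have : (fun i => max (v i) 0) = fun i => max (-v i) 0 := by
    refine eq_of_subdivisionMap_eq hS hS (fun i => le_max_right _ _) (fun i => le_max_right _ _) ?_
    rw [← sub_eq_zero, ← map_sub, ← hv]
    congr 1
    funext i
    exact max_zero_sub_max_neg_zero_eq_self (v i)
  funext i
  rw [← max_zero_sub_max_neg_zero_eq_self (v i)]
  exact sub_eq_zero.2 (congrFun this i)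

variable (ι) in
/-- The contraction rate of the parametrizations of the simplices of the chromatic subdivision. -/
def contractionRate : ℝ := 1 - 1 / (2 * (Fintype.card ι : ℝ) - 1)

lemma contractionRate_nonneg [Nonempty ι] : 0 ≤ contractionRate ι := by
  have : (1 : ℝ) ≤ Fintype.card ι := by exact_mod_cast Fintype.card_pos
  have h := div_le_one_of_le₀ (a := (1 : ℝ)) (b := 2 * (Fintype.card ι : ℝ) - 1)
    (by linarith) (by linarith)
  unfold contractionRate
  linarith

lemma contractionRate_lt_one [Nonempty ι] : contractionRate ι < 1 := by
  have : (1 : ℝ) ≤ Fintype.card ι := by exact_mod_cast Fintype.card_pos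
  have h : 0 < 1 / (2 * (Fintype.card ι : ℝ) - 1) := one_div_pos.2 (by linarith)
  unfold contractionRate
  linarith

/-- The simplices of the chromatic subdivision are uniformly smaller than the standard simplex:
the weights of their vertices at a common vertex of the carriers are bounded below. -/
lemma sum_abs_subdivisionMap_le [Nonempty ι] {S : ι → Finset ι} (hS : IsSnapshot S) {v : ι → ℝ}
    (hv : ∑ i, v i = 0) : ∑ j, |subdivisionMap S v j| ≤ contractionRate ι * ∑ i, |v i| := by
  -- The smallest set of the chain belongs to some k, and k then lies in every S i. All columns thus
  -- have k-th entry at least δ. Subtracting δ there does not affect the image of a vector of sum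
  -- zero, and leaves nonnegative columns of total 1 − δ.
  classical
  obtain ⟨k, -, hk⟩ := Finset.exists_min_image Finset.univ (fun i => (S i).card)
    Finset.univ_nonempty
  have hkS : ∀ i, k ∈ S i := fun i => by
    rcases hS.chain k i with h | h
    · exact h (hS.self_mem k)
    · rw [Finset.eq_of_subset_of_card_le h (hk i (Finset.mem_univ i))]
      exact hS.self_mem k
  set δ : ℝ := 1 / (2 * (Fintype.card ι : ℝ) - 1) with hδ
  set u : ι → ι → ℝ := fun i j => chromaticVertex i (S i) j - if j = k then δ else 0 with hu
  have hu0 : ∀ i j, 0 ≤ u i j := by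
    intro i j
    simp only [hu]
    split_ifs with h
    · subst h
      exact sub_nonneg.2 (inv_le_chromaticVertex (hS.self_mem i) (hkS i))
    · simpa using chromaticVertex_nonneg (hS.self_mem i) j
  have hu1 : ∀ i, ∑ j, u i j = contractionRate ι := fun i => by
    simp [hu, Finset.sum_sub_distrib, sum_chromaticVertex (hS.self_mem i), contractionRate, hδ]
  have hM : ∀ j, subdivisionMap S v j = ∑ i, v i * u i j := by
    intro j
    simp only [subdivisionMap_apply, Finset.sum_apply, Pi.smul_apply, smul_eq_mul, hu, mul_sub,
      Finset.sum_sub_distrib, ← Finset.sum_mul, hv, zero_mul, sub_zero]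
  calc ∑ j, |subdivisionMap S v j| ≤ ∑ j, ∑ i, |v i| * u i j := by
        refine Finset.sum_le_sum fun j _ => ?_
        rw [hM]
        refine (Finset.abs_sum_le_sum_abs _ _).trans (Finset.sum_le_sum fun i _ => ?_)
        rw [abs_mul, abs_of_nonneg (hu0 i j)]
    _ = contractionRate ι * ∑ i, |v i| := by
        rw [Finset.sum_comm, Finset.mul_sum]
        exact Finset.sum_congr rfl fun i _ => by rw [← Finset.mul_sum, hu1, mul_comm]

lemma stdFace_subset (J : Finset ι) : stdFace J ⊆ stdSimplex ℝ ι := by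
  classical
  refine convexHull_min ?_ (convex_stdSimplex ℝ ι)
  rintro _ ⟨i, -, rfl⟩
  convert single_mem_stdSimplex ℝ i

lemma convexHull_chromaticVertex (S : ι → Finset ι) (J : Finset ι) :
    convexHull ℝ ((fun i => chromaticVertex i (S i)) '' (J : Set ι)) =
      subdivisionMap S '' stdFace J := by
  classical
  rw [stdFace, (subdivisionMap S).image_convexHull, image_image]
  congr 1
  refine image_congr fun i _ => ?_
  rw [subdivisionMap_apply, Finset.sum_eq_single i]
  · simp
  · intro j _ hj
    simp [hj]
  · simp

/-- Each simplex of the iterated subdivision is parametrized by a face of the standard simplex, by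
means of a linear map inverse to the iterated folding map. -/
structure IsCellParam (r : ℕ) (τ : Set (ι → ℝ)) (J : Finset ι) (M : (ι → ℝ) ≃ₗ[ℝ] (ι → ℝ)) :
    Prop where
  eq_image : τ = M '' stdFace J
  fold : ∀ t ∈ stdFace J, thomFold^[r] (M t) = t
  mapsTo : MapsTo M (stdSimplex ℝ ι) (stdSimplex ℝ ι)
  sum_eq : ∀ v, ∑ i, M v i = ∑ i, v i
  sum_abs_le : Nonempty ι → ∀ v, ∑ i, v i = 0 →
    ∑ i, |M v i| ≤ contractionRate ι ^ r * ∑ i, |v i|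

lemma exists_isCellParam {r : ℕ} : ∀ {τ : Set (ι → ℝ)}, τ ∈ iteratedThomSubdivision ι r →
    ∃ J M, IsCellParam r τ J M := by
  induction r with
  | zero =>
    rintro τ ⟨J, -, rfl⟩
    refine ⟨J, LinearEquiv.refl ℝ _, ?_, fun t _ => rfl, fun t ht => ht, fun v => rfl,
      fun _ v _ => by simp⟩
    exact (image_id _).symm
  | succ r ih =>
    rintro τ ⟨ρ, hρ, κ, ⟨S, hS, J', -, rfl⟩, hκ, rfl⟩
    obtain ⟨J, M, h⟩ := ih hρ
    rw [convexHull_chromaticVertex] at hκ ⊢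
    -- The containment required in the definition of the iterated subdivision ensures that the new
    -- cell is a full linear image of a face, not a truncated one.
    have hsub : subdivisionMap S '' stdFace J' ⊆ stdFace J := by
      intro x hx
      obtain ⟨p, hp, rfl⟩ := hκ hx
      rw [h.eq_image] at hp
      obtain ⟨t, ht, rfl⟩ := hp
      rwa [h.fold t ht]
    refine ⟨J', (LinearEquiv.ofInjectiveEndo _ (subdivisionMap_injective hS)).trans M, ?_,
      fun t ht => ?_, fun t ht => ?_, fun v => ?_, fun hι v hv => ?_⟩
    · ext p
      constructor
      · rintro ⟨hp, hpκ⟩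
        rw [h.eq_image] at hp
        obtain ⟨t, ht, rfl⟩ := hp
        rw [h.fold t ht] at hpκ
        obtain ⟨s, hs, rfl⟩ := hpκ
        exact ⟨s, hs, rfl⟩
      · rintro ⟨s, hs, rfl⟩
        have := hsub (mem_image_of_mem _ hs)
        refine ⟨h.eq_image ▸ mem_image_of_mem M this, ?_⟩
        change thomFold^[r] (M (subdivisionMap S s)) ∈ _
        rw [h.fold _ this]
        exact mem_image_of_mem _ hs
    · change thomFold^[r + 1] (M (subdivisionMap S t)) = t
      rw [Function.iterate_succ_apply', h.fold _ (hsub (mem_image_of_mem _ ht)),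
        thomFold_subdivisionMap hS (stdFace_subset J' ht)]
    · exact h.mapsTo (subdivisionMap_mem_stdSimplex hS ht)
    · exact (h.sum_eq _).trans (sum_subdivisionMap hS v)
    · refine (h.sum_abs_le hι (subdivisionMap S v) ((sum_subdivisionMap hS v).trans hv)).trans ?_
      rw [pow_succ, mul_assoc]
      exact mul_le_mul_of_nonneg_left (sum_abs_subdivisionMap_le hS hv)
        (pow_nonneg contractionRate_nonneg r)

namespace IsCellParam

variable {r : ℕ} {τ : Set (ι → ℝ)} {J : Finset ι} {M : (ι → ℝ) ≃ₗ[ℝ] (ι → ℝ)}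

lemma subset (h : IsCellParam r τ J M) : τ ⊆ stdSimplex ℝ ι := by
  rw [h.eq_image]
  exact (h.mapsTo.mono_left (stdFace_subset J)).image_subset

lemma convex (h : IsCellParam r τ J M) : Convex ℝ τ := by
  rw [h.eq_image]
  exact (convex_stdFace J).linear_image M.toLinearMap

lemma fold_eq (h : IsCellParam r τ J M) {p : ι → ℝ} (hp : p ∈ τ) :
    thomFold^[r] p = M.symm p := by
  rw [h.eq_image] at hp
  obtain ⟨t, ht, rfl⟩ := hp
  rw [h.fold t ht, M.symm_apply_apply]

lemma sum_symm_eq (h : IsCellParam r τ J M) (v : ι → ℝ) : ∑ i, M.symm v i = ∑ i, v i := by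
  rw [← h.sum_eq, M.apply_symm_apply]

lemma sum_abs_le_symm (h : IsCellParam r τ J M) [Nonempty ι] {v : ι → ℝ} (hv : ∑ i, v i = 0) :
    ∑ i, |v i| ≤ contractionRate ι ^ r * ∑ i, |M.symm v i| := by
  simpa using h.sum_abs_le inferInstance (M.symm v) ((h.sum_symm_eq v).trans hv)

lemma sum_eq_zero (h : IsCellParam r τ J M) {v : ι → ℝ} (hv : v ∈ vectorSpan ℝ τ) :
    ∑ i, v i = 0 := by
  have : vectorSpan ℝ τ ≤ LinearMap.ker (∑ i, LinearMap.proj i : (ι → ℝ) →ₗ[ℝ] ℝ) := by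
    rw [vectorSpan_def, Submodule.span_le]
    rintro _ ⟨p, hp, q, hq, rfl⟩
    simp [LinearMap.sum_apply, (h.subset hp).2, (h.subset hq).2]
  simpa [LinearMap.sum_apply] using this hv

end IsCellParam

end Cells

/-! ### Calculus: local inverses and derivatives on thin convex sets -/

/-- The inverse function theorem for maps between manifolds without boundary. -/
theorem exists_contMDiffAt_rightInverse {E E' H H' M N : Type*}
    [NormedAddCommGroup E] [NormedSpace ℝ E] [FiniteDimensional ℝ E]
    [NormedAddCommGroup E'] [NormedSpace ℝ E'] [FiniteDimensional ℝ E']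
    [TopologicalSpace H] [TopologicalSpace H'] {I : ModelWithCorners ℝ E H}
    {J : ModelWithCorners ℝ E' H'} [I.Boundaryless] [J.Boundaryless]
    [TopologicalSpace M] [ChartedSpace H M] [IsManifold I ∞ M]
    [TopologicalSpace N] [ChartedSpace H' N] [IsManifold J ∞ N]
    (hdim : Module.finrank ℝ E = Module.finrank ℝ E') {f : M → N} {x : M}
    (hf : ContMDiffAt I J ∞ f x) (hinj : ∀ z, mfderiv I J f x z = 0 → z = 0) :
    ∃ G : N → M, ContMDiffAt J I ∞ G (f x) ∧ G (f x) = x ∧ ∀ᶠ y in 𝓝 (f x), f (G y) = y := by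
  have : CompleteSpace E := FiniteDimensional.complete ℝ E
  set ψ : E → E' := writtenInExtChartAt I J x f with hψ
  have hψs : ContDiffAt ℝ ∞ ψ (extChartAt I x x) := by
    have := (contMDiffAt_iff.1 hf).2
    rwa [I.range_eq_univ, contDiffWithinAt_univ] at this
  have hd : MDifferentiableAt I J f x := hf.mdifferentiableAt (by simp)
  have hmf : mfderiv I J f x = fderiv ℝ ψ (extChartAt I x x) := by
    rw [hd.mfderiv, I.range_eq_univ, fderivWithin_univ]
  have hinj' : Function.Injective (fderiv ℝ ψ (extChartAt I x x)).toLinearMap := by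
    rw [← LinearMap.ker_eq_bot, LinearMap.ker_eq_bot']
    intro z hz
    refine hinj z ?_
    rw [hmf]
    exact hz
  set L : E ≃L[ℝ] E' :=
    (LinearEquiv.ofInjectiveOfFinrankEq _ hinj' hdim).toContinuousLinearEquiv
  have hLd : HasFDerivAt ψ (L : E →L[ℝ] E') (extChartAt I x x) := by
    have e : (L : E →L[ℝ] E') = fderiv ℝ ψ (extChartAt I x x) := by
      ext z
      rfl
    rw [e]
    exact (hψs.differentiableAt (by simp)).hasFDerivAt
  set K : E' → E := hψs.localInverse hLd (by simp)
  have hψx : ψ (extChartAt I x x) = extChartAt J (f x) (f x) := by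
    simp [hψ, writtenInExtChartAt]
  have hK0 : K (extChartAt J (f x) (f x)) = extChartAt I x x := by
    rw [← hψx]
    exact hψs.localInverse_apply_image hLd (by simp)
  have hKs : ContDiffAt ℝ ∞ K (extChartAt J (f x) (f x)) := by
    rw [← hψx]
    exact hψs.to_localInverse hLd (by simp)
  have hKr : ∀ᶠ y in 𝓝 (extChartAt J (f x) (f x)), ψ (K y) = y := by
    rw [← hψx]
    exact (hψs.hasStrictFDerivAt' hLd (by simp)).eventually_right_inverse
  set G : N → M := fun y => (extChartAt I x).symm (K (extChartAt J (f x) y))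
  have hGx : G (f x) = x := by
    change (extChartAt I x).symm (K _) = x
    rw [hK0]
    exact extChartAt_to_inv x
  have hGs : ContMDiffAt J I ∞ G (f x) := by
    have h₁ : ContMDiffAt 𝓘(ℝ, E) I ∞ (extChartAt I x).symm (K (extChartAt J (f x) (f x))) := by
      rw [hK0]
      exact (contMDiffOn_extChartAt_symm x).contMDiffAt (extChartAt_target_mem_nhds x)
    exact ContMDiffAt.comp (f x) h₁ (hKs.contMDiffAt.comp (f x) contMDiffAt_extChartAt)
  refine ⟨G, hGs, hGx, ?_⟩
  have hfG : ContinuousAt (f ∘ G) (f x) := by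
    refine ContinuousAt.comp ?_ hGs.continuousAt
    rw [hGx]
    exact hf.continuousAt
  have hfGx : (f ∘ G) (f x) = f x := by simp [hGx]
  have e₁ : ∀ᶠ y in 𝓝 (f x), (f ∘ G) y ∈ (extChartAt J (f x)).source :=
    hfG.eventually (by rw [hfGx]; exact extChartAt_source_mem_nhds (f x))
  have e₂ : ∀ᶠ y in 𝓝 (f x), y ∈ (extChartAt J (f x)).source := extChartAt_source_mem_nhds (f x)
  have e₃ := (continuousAt_extChartAt (I := J) (f x)).eventually hKr
  filter_upwards [e₁, e₂, e₃] with y h₁ h₂ h₃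
  exact (extChartAt J (f x)).injOn h₁ h₂ h₃

/-- A simplex may have empty interior, so derivatives within it are not unique. They do agree on
tangent directions, and segments from p to the other points of the convex set span the whole
direction space. -/
lemma eqOn_vectorSpan_of_hasFDerivWithinAt {E F : Type*} [NormedAddCommGroup E]
    [NormedSpace ℝ E] [NormedAddCommGroup F] [NormedSpace ℝ F] {f : E → F} {L L' : E →L[ℝ] F}
    {s : Set E} {p : E} (hs : Convex ℝ s) (hp : p ∈ s) (h : HasFDerivWithinAt f L s p)
    (h' : HasFDerivWithinAt f L' s p) {v : E} (hv : v ∈ vectorSpan ℝ s) : L v = L' v := by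
  have hle : vectorSpan ℝ s ≤ LinearMap.eqLocus L.toLinearMap L'.toLinearMap := by
    rw [vectorSpan_eq_span_vsub_set_right ℝ hp, Submodule.span_le]
    rintro _ ⟨q, hq, rfl⟩
    exact h.unique_on h' (mem_tangentConeAt_of_segment_subset (hs.segment_subset hp hq))
  exact hle hv

lemma eqOn_vectorSpan_of_hasMFDerivWithinAt {E F H M : Type*} [NormedAddCommGroup E]
    [NormedSpace ℝ E] [NormedAddCommGroup F] [NormedSpace ℝ F] [TopologicalSpace H]
    {I : ModelWithCorners ℝ F H} [TopologicalSpace M] [ChartedSpace H M] {f : E → M}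
    {s : Set E} {p : E} {L L' : TangentSpace 𝓘(ℝ, E) p →L[ℝ] TangentSpace I (f p)}
    (hs : Convex ℝ s) (hp : p ∈ s) (h : HasMFDerivWithinAt 𝓘(ℝ, E) I f s p L)
    (h' : HasMFDerivWithinAt 𝓘(ℝ, E) I f s p L') {v : E} (hv : v ∈ vectorSpan ℝ s) :
    L v = L' v := by
  have h₁ := h.2
  have h₂ := h'.2
  simp only [mfld_simps] at h₁ h₂
  exact eqOn_vectorSpan_of_hasFDerivWithinAt hs hp h₁ h₂ hv

/-! ### Smooth dependence of the inverse exponential on both points -/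

section ExpInverse

variable {n : ℕ} {X : Type*} [TopologicalSpace X] [ChartedSpace (EuclideanSpace ℝ (Fin n)) X]
  [IsManifold (𝓡 n) ∞ X] (g : Metric n X)

lemma continuous_length :
    Continuous fun w : TangentBundle (𝓡 n) X => length g w.snd := by
  have h : Continuous fun w : TangentBundle (𝓡 n) X =>
      (⟨w.proj, g.inner w.proj w.snd w.snd⟩ : TotalSpace ℝ (Bundle.Trivial X ℝ)) := by
    refine Continuous.clm_bundle_apply₂ (F₁ := EuclideanSpace ℝ (Fin n))
      (F₂ := EuclideanSpace ℝ (Fin n)) (F₃ := ℝ)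
      (E₁ := fun x : X => TangentSpace (𝓡 n) x) (E₂ := fun x : X => TangentSpace (𝓡 n) x)
      (E₃ := Bundle.Trivial X ℝ) (b := fun w : TangentBundle (𝓡 n) X => w.proj)
      (v := fun w => w.snd) (w := fun w => w.snd) (ψ := fun w => g.inner w.proj) ?_ ?_ ?_
    · exact g.contMDiff.continuous.comp
        (FiberBundle.continuous_proj _ (fun x : X => TangentSpace (𝓡 n) x))
    · exact continuous_id
    · exact continuous_id
  exact Real.continuous_sqrt.comp (continuous_snd.comp
    ((Bundle.Trivial.homeomorphProd X ℝ).continuous.comp h))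

variable {g}

lemma length_nonneg {x : X} (v : TangentSpace (𝓡 n) x) : 0 ≤ length g v := Real.sqrt_nonneg _

lemma length_zero {x : X} : length g (0 : TangentSpace (𝓡 n) x) = 0 := by simp [length]

lemma length_pos {x : X} {v : TangentSpace (𝓡 n) x} (hv : v ≠ 0) : 0 < length g v :=
  Real.sqrt_pos.2 (g.pos x v hv)

lemma length_smul {x : X} (a : ℝ) (v : TangentSpace (𝓡 n) x) :
    length g (a • v) = |a| * length g v := by
  unfold length
  rw [map_smul, map_smul]
  simp only [_root_.smul_apply, smul_eq_mul]
  rw [← mul_assoc, Real.sqrt_mul (mul_self_nonneg a), Real.sqrt_mul_self_eq_abs]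

variable {ρ : X → ℝ}

lemma IsAdmissible.isOpen_discBundle (hρ : IsAdmissible g ρ) : IsOpen (discBundle g ρ) :=
  isOpen_lt (continuous_length g) (hρ.continuous.comp
    (FiberBundle.continuous_proj _ (fun x : X => TangentSpace (𝓡 n) x)))

lemma IsAdmissible.contMDiffAt_expMap (hρ : IsAdmissible g ρ) {w : TangentBundle (𝓡 n) X}
    (hw : w ∈ discBundle g ρ) : ContMDiffAt (𝓡 n).tangent (𝓡 n) ∞ (expMap g) w :=
  (hρ.submersion w hw).contMDiffAt

lemma contMDiff_tangentBundle_proj : ContMDiff (𝓡 n).tangent (𝓡 n) ∞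
    (TotalSpace.proj : TangentBundle (𝓡 n) X → X) :=
  Bundle.contMDiff_proj (fun x : X => TangentSpace (𝓡 n) x)

variable (g ρ) in
/-- The map `(x, y) ↦ exp_x⁻¹ y`, where `exp_x` is restricted to the disc `D_x X`. -/
def expInv (q : X × X) : TangentBundle (𝓡 n) X :=
  ⟨q.1, Function.invFunOn (fun v : TangentSpace (𝓡 n) q.1 => expMap g ⟨q.1, v⟩) (disc g ρ q.1) q.2⟩

lemma IsAdmissible.expInv_apply (hρ : IsAdmissible g ρ) {w : TangentBundle (𝓡 n) X}
    (hw : w ∈ discBundle g ρ) : expInv g ρ (w.proj, expMap g w) = w := by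
  obtain ⟨x, v⟩ := w
  have : Function.invFunOn (fun v : TangentSpace (𝓡 n) x => expMap g ⟨x, v⟩) (disc g ρ x)
      (expMap g ⟨x, v⟩) = v := (hρ.injOn x).leftInvOn_invFunOn hw
  exact congrArg (TotalSpace.mk x) this

/-- Inverses of the exponential map depend smoothly on both points. -/
lemma IsAdmissible.contMDiffAt_expInv (hρ : IsAdmissible g ρ) {w : TangentBundle (𝓡 n) X}
    (hw : w ∈ discBundle g ρ) :
    ContMDiffAt ((𝓡 n).prod (𝓡 n)) (𝓡 n).tangent ∞ (expInv g ρ) (w.proj, expMap g w) := by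
  set f : TangentBundle (𝓡 n) X → X × X := fun u => (u.proj, expMap g u) with hf
  have hπ : ContMDiffAt (𝓡 n).tangent (𝓡 n) ∞ (TotalSpace.proj : TangentBundle (𝓡 n) X → X) w :=
    contMDiff_tangentBundle_proj.contMDiffAt
  have hexp := hρ.contMDiffAt_expMap hw
  have hfs : ContMDiffAt (𝓡 n).tangent ((𝓡 n).prod (𝓡 n)) ∞ f w := hπ.prodMk hexp
  obtain ⟨G, hG, hGw, hGr⟩ := exists_contMDiffAt_rightInverse (by rfl) hfs (by
    intro z hz
    rw [hf, mfderiv_prodMk (hπ.mdifferentiableAt (by simp)) (hexp.mdifferentiableAt (by simp))] at hz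
    have h₁ := congrArg Prod.fst hz
    have h₂ := congrArg Prod.snd hz
    exact (Submodule.mem_bot ℝ).1 ((hρ.immersive w hw).le_bot ⟨h₁, h₂⟩))
  refine hG.congr_of_eventuallyEq ?_
  have hD : ∀ᶠ y in 𝓝 (f w), G y ∈ discBundle g ρ :=
    hG.continuousAt.eventually (by
      rw [hGw]
      exact hρ.isOpen_discBundle.mem_nhds hw)
  filter_upwards [hD, hGr] with y h₁ h₂
  -- Near the point, the local inverse takes values in the disc bundle, where injectivity of exp on
  -- each disc identifies it with `expInv`.
  conv_lhs => rw [← h₂]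
  exact hρ.expInv_apply h₁

end ExpInverse

/-! ### Folding of X; continuity and piecewise smoothness of the jiggling -/

section Triangulation

variable {n : ℕ} {X : Type*} [TopologicalSpace X] [ChartedSpace (EuclideanSpace ℝ (Fin n)) X]
  {V : Type*}

namespace SmoothTriangulation

variable (T : SmoothTriangulation n X V)

lemma carrier_mem (x : X) : T.carrier x ∈ T.complex := (T.covers x).choose_spec.1

lemma coord_mem (x : X) : T.coord x ∈ stdSimplex ℝ (T.carrier x) :=
  (T.covers x).choose_spec.2.choose_spec.1

lemma param_coord (x : X) : T.param (T.carrier x) (T.coord x) = x :=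
  (T.covers x).choose_spec.2.choose_spec.2

variable {T} {σ : Finset V}

/-- The folding map is given on every simplex by the iterate of Thom's folding map. -/
lemma fold_param (hσ : σ ∈ T.complex) {p : σ → ℝ} (hp : p ∈ stdSimplex ℝ σ) (r : ℕ) :
    T.fold r (T.param σ p) = T.param σ (thomFold^[r] p) := by
  rw [fold, T.eq_iff _ (T.carrier_mem _) _ hσ _ (iterate_thomFold_mem_stdSimplex (T.coord_mem _) r) _
    (iterate_thomFold_mem_stdSimplex hp r)]
  refine extendCoord_iterate_thomFold_eq (T.coord_mem _) hp ?_ r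
  rw [← T.eq_iff _ (T.carrier_mem _) _ hσ _ (T.coord_mem _) _ hp, T.param_coord]

lemma param_mem_cell {p : σ → ℝ} (hp : p ∈ stdSimplex ℝ σ) : T.param σ p ∈ T.cell σ :=
  mem_image_of_mem _ hp

lemma fold_mem_cell (hσ : σ ∈ T.complex) {x : X} (hx : x ∈ T.cell σ) (r : ℕ) :
    T.fold r x ∈ T.cell σ := by
  obtain ⟨p, hp, rfl⟩ := hx
  rw [fold_param hσ hp]
  exact param_mem_cell (iterate_thomFold_mem_stdSimplex hp r)

lemma exists_mem_cell (x : X) : ∃ σ ∈ T.complex, x ∈ T.cell σ :=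
  ⟨_, T.carrier_mem x, _, T.coord_mem x, T.param_coord x⟩

lemma continuousOn_param (hσ : σ ∈ T.complex) : ContinuousOn (T.param σ) (stdSimplex ℝ σ) :=
  (T.smooth σ hσ).continuousOn

lemma isCompact_cell (hσ : σ ∈ T.complex) : IsCompact (T.cell σ) :=
  (isCompact_stdSimplex ℝ σ).image_of_continuousOn (continuousOn_param hσ)

lemma continuous_fold [T2Space X] (r : ℕ) : Continuous (T.fold r) := by
  refine T.locallyFinite.continuous ?_ (fun σ => (T.isCompact_cell σ.2).isClosed) fun σ => ?_
  · refine eq_univ_of_forall fun x => ?_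
    obtain ⟨σ, hσ, hx⟩ := T.exists_mem_cell x
    exact mem_iUnion.2 ⟨⟨σ, hσ⟩, hx⟩
  · refine (isCompact_stdSimplex ℝ σ.1).continuousOn_image_of_comp (continuousOn_param σ.2) ?_
    exact ((continuousOn_param σ.2).comp (continuousOn_iterate_thomFold r)
      fun p hp => iterate_thomFold_mem_stdSimplex hp r).congr fun p hp => fold_param σ.2 hp r

end SmoothTriangulation

variable {T : SmoothTriangulation n X V} {σ : Finset V} 
  {r : ℕ} {τ : Set (σ → ℝ)} {J : Finset σ} {M : (σ → ℝ) ≃ₗ[ℝ] (σ → ℝ)}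

lemma IsCellParam.fold_param (h : IsCellParam r τ J M) (hσ : σ ∈ T.complex) {p : σ → ℝ}
    (hp : p ∈ τ) : T.fold r (T.param σ p) = T.param σ (M.symm p) := by
  rw [SmoothTriangulation.fold_param hσ (h.subset hp), h.fold_eq hp]

lemma IsCellParam.mapsTo_symm (h : IsCellParam r τ J M) : MapsTo M.symm τ (stdSimplex ℝ σ) :=
  fun p hp => by
    rw [← h.fold_eq hp]
    exact iterate_thomFold_mem_stdSimplex (h.subset hp) r

variable [IsManifold (𝓡 n) ∞ X] {g : Metric n X} {ρ : X → ℝ}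

lemma IsFine.exists_expMap_eq (hT : IsFine g ρ T) (hσ : σ ∈ T.complex) {x y : X}
    (hx : x ∈ T.cell σ) (hy : y ∈ T.cell σ) :
    ∃ w ∈ discBundle g ρ, w.proj = x ∧ expMap g w = y := by
  obtain ⟨v, hv, rfl⟩ := hT σ hσ x hx hy
  exact ⟨⟨x, v⟩, hv, rfl, rfl⟩

lemma expInv_mem (hρ : IsAdmissible g ρ) (hT : IsFine g ρ T) (hσ : σ ∈ T.complex) {x y : X}
    (hx : x ∈ T.cell σ) (hy : y ∈ T.cell σ) :
    expInv g ρ (x, y) ∈ discBundle g ρ ∧ expMap g (expInv g ρ (x, y)) = y := by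
  obtain ⟨w, hw, rfl, rfl⟩ := hT.exists_expMap_eq hσ hx hy
  rw [hρ.expInv_apply hw]
  exact ⟨hw, rfl⟩

lemma contMDiffAt_expInv (hρ : IsAdmissible g ρ) (hT : IsFine g ρ T) (hσ : σ ∈ T.complex)
    {x y : X} (hx : x ∈ T.cell σ) (hy : y ∈ T.cell σ) :
    ContMDiffAt ((𝓡 n).prod (𝓡 n)) (𝓡 n).tangent ∞ (expInv g ρ) (x, y) := by
  obtain ⟨w, hw, rfl, rfl⟩ := hT.exists_expMap_eq hσ hx hy
  exact hρ.contMDiffAt_expInv hw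

lemma jiggling_mem (hρ : IsAdmissible g ρ) (hT : IsFine g ρ T) (r : ℕ) (x : X) :
    jiggling g ρ T r x ∈ discBundle g ρ ∧ expMap g (jiggling g ρ T r x) = T.fold r x := by
  obtain ⟨σ, hσ, hx⟩ := T.exists_mem_cell x
  exact expInv_mem hρ hT hσ hx (SmoothTriangulation.fold_mem_cell hσ hx r)

lemma continuous_jiggling [T2Space X] (hρ : IsAdmissible g ρ) (hT : IsFine g ρ T) (r : ℕ) :
    Continuous (jiggling g ρ T r) := by
  refine continuous_iff_continuousAt.2 fun x => ?_
  obtain ⟨σ, hσ, hx⟩ := T.exists_mem_cell x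
  exact ContinuousAt.comp (f := fun x => (x, T.fold r x))
    (contMDiffAt_expInv hρ hT hσ hx (SmoothTriangulation.fold_mem_cell hσ hx r)).continuousAt
    (continuous_id.prodMk (SmoothTriangulation.continuous_fold r)).continuousAt

/-- On a cell the folding is φ ∘ M⁻¹ in coordinates, so the jiggling is `expInv` applied to the
smooth pair (φ, φ ∘ M⁻¹). -/
lemma contMDiffOn_jiggling (hρ : IsAdmissible g ρ) (hT : IsFine g ρ T) (hσ : σ ∈ T.complex)
    (hτ : τ ∈ iteratedThomSubdivision σ r) :
    ContMDiffOn 𝓘(ℝ, σ → ℝ) (𝓡 n).tangent ∞ (jiggling g ρ T r ∘ T.param σ) τ := by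
  obtain ⟨J, M, h⟩ := exists_isCellParam hτ
  have h₁ : ContMDiffOn 𝓘(ℝ, σ → ℝ) (𝓡 n) ∞ (T.param σ) τ := (T.smooth σ hσ).mono h.subset
  have h₂ : ContMDiffOn 𝓘(ℝ, σ → ℝ) (𝓡 n) ∞ (T.param σ ∘ M.symm) τ :=
    (T.smooth σ hσ).comp
      (M.symm.toLinearMap.toContinuousLinearMap.contDiff.contMDiff.contMDiffOn) h.mapsTo_symm
  intro p hp
  refine ((contMDiffAt_expInv hρ hT hσ (SmoothTriangulation.param_mem_cell (h.subset hp))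
    (SmoothTriangulation.param_mem_cell (h.mapsTo_symm hp))).comp_contMDiffWithinAt p
    ((h₁ p hp).prodMk (h₂ p hp))).congr (fun q hq => ?_) ?_
  · exact congrArg (fun y => expInv g ρ (T.param σ q, y)) (h.fold_param hσ hq)
  · exact congrArg (fun y => expInv g ρ (T.param σ p, y)) (h.fold_param hσ hp)

end Triangulation

/-! ### Thickening the simplex to a set with unique derivatives -/

section Projection

variable (ι : Type*) [Fintype ι]

/-- The projection to the affine hyperplane of barycentric coordinates. -/
def toHyperplane (x : ι → ℝ) : ι → ℝ :=
  x + ((1 - ∑ i, x i) / (Fintype.card ι : ℝ)) • (1 : ι → ℝ)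

/-- The derivative of the projection to the affine hyperplane of barycentric coordinates. -/
def toHyperplaneDeriv : (ι → ℝ) →L[ℝ] (ι → ℝ) :=
  ContinuousLinearMap.id ℝ (ι → ℝ) -
    ((Fintype.card ι : ℝ)⁻¹ • ∑ i, ContinuousLinearMap.proj (R := ℝ) (φ := fun _ : ι => ℝ) i).smulRight
      (1 : ι → ℝ)

variable {ι}

lemma toHyperplane_of_sum_eq_one {x : ι → ℝ} (hx : ∑ i, x i = 1) : toHyperplane ι x = x := by
  simp [toHyperplane, hx]

lemma toHyperplaneDeriv_of_sum_eq_zero {v : ι → ℝ} (hv : ∑ i, v i = 0) :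
    toHyperplaneDeriv ι v = v := by
  simp [toHyperplaneDeriv, hv]

lemma toHyperplane_eq (x : ι → ℝ) :
    toHyperplane ι x = toHyperplaneDeriv ι x + ((Fintype.card ι : ℝ)⁻¹) • (1 : ι → ℝ) := by
  funext i
  simp [toHyperplane, toHyperplaneDeriv]
  ring

lemma hasFDerivAt_toHyperplane (x : ι → ℝ) :
    HasFDerivAt (toHyperplane ι) (toHyperplaneDeriv ι) x := by
  have : toHyperplane ι = fun x => toHyperplaneDeriv ι x + ((Fintype.card ι : ℝ)⁻¹) • (1 : ι → ℝ) :=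
    funext toHyperplane_eq
  rw [this]
  exact (toHyperplaneDeriv ι).hasFDerivAt.add_const _

lemma contDiff_toHyperplane : ContDiff ℝ ∞ (toHyperplane ι) := by
  have : toHyperplane ι = fun x => toHyperplaneDeriv ι x + ((Fintype.card ι : ℝ)⁻¹) • (1 : ι → ℝ) :=
    funext toHyperplane_eq
  rw [this]
  exact (toHyperplaneDeriv ι).contDiff.add contDiff_const

variable (ι) in
/-- The set of points projecting to the standard simplex. -/
def thickSimplex : Set (ι → ℝ) := toHyperplane ι ⁻¹' stdSimplex ℝ ι

lemma stdSimplex_subset_thickSimplex : stdSimplex ℝ ι ⊆ thickSimplex ι := fun x hx => by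
  rwa [thickSimplex, mem_preimage, toHyperplane_of_sum_eq_one hx.2]

/-- The thickened simplex is convex, and the origin, which projects to the barycentre, is interior
to it. -/
lemma uniqueDiffOn_thickSimplex [Nonempty ι] : UniqueDiffOn ℝ (thickSimplex ι) := by
  have hN : (0 : ℝ) < Fintype.card ι := by exact_mod_cast Fintype.card_pos
  have hsum : ∀ x : ι → ℝ, ∑ i, toHyperplane ι x i = 1 := fun x => by
    simp only [toHyperplane, Pi.add_apply, Pi.smul_apply, Pi.one_apply, smul_eq_mul, mul_one,
      Finset.sum_add_distrib, Finset.sum_const, Finset.card_univ, nsmul_eq_mul]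
    field_simp
    ring
  refine uniqueDiffOn_convex ?_ ⟨0, ?_⟩
  · have : thickSimplex ι = (toHyperplaneDeriv ι).toLinearMap ⁻¹'
        ((fun y => y + ((Fintype.card ι : ℝ)⁻¹) • (1 : ι → ℝ)) ⁻¹' stdSimplex ℝ ι) := by
      ext x
      simp [thickSimplex, toHyperplane_eq]
    rw [this]
    exact ((convex_stdSimplex ℝ ι).translate_preimage_left _).linear_preimage _
  · refine mem_interior.2 ⟨⋂ i, {x | 0 < toHyperplane ι x i}, fun x hx => ?_, ?_, ?_⟩
    · exact ⟨fun i => (mem_iInter.1 hx i).le, hsum x⟩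
    · exact isOpen_iInter_of_finite fun i => isOpen_lt continuous_const
        ((continuous_apply i).comp contDiff_toHyperplane.continuous)
    · refine mem_iInter.2 fun i => ?_
      simp [toHyperplane, hN]

/-- The unit sphere of the hyperplane of vectors of sum zero. -/
lemma isCompact_sum_abs_eq_one : IsCompact {v : ι → ℝ | ∑ i, |v i| = 1 ∧ ∑ i, v i = 0} := by
  refine Metric.isCompact_of_isClosed_isBounded ?_ ?_
  · exact (isClosed_eq (by fun_prop) continuous_const).inter
      (isClosed_eq (by fun_prop) continuous_const)
  · refine (Metric.isBounded_closedBall (x := (0 : ι → ℝ)) (r := 1)).subset fun v hv => ?_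
    rw [mem_closedBall_zero_iff, pi_norm_le_iff_of_nonneg zero_le_one]
    intro i
    rw [Real.norm_eq_abs, ← hv.1]
    exact Finset.single_le_sum (f := fun i => |v i|) (fun i _ => abs_nonneg _) (Finset.mem_univ i)

end Projection

/-! ### Length distortion on a simplex and tangent vectors to the jiggling -/

section Bounds

variable {n : ℕ} {X : Type*} [TopologicalSpace X] [ChartedSpace (EuclideanSpace ℝ (Fin n)) X]
  [IsManifold (𝓡 n) ∞ X] {g : Metric n X} {ρ : X → ℝ} {V : Type*}
  {T : SmoothTriangulation n X V} {σ : Finset V}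

lemma length_congr {x y : X} (h : x = y) (v : EuclideanSpace ℝ (Fin n)) :
    length g (x := x) v = length g (x := y) v := by
  subst h
  rfl

/-- Composing φ with the projection to the hyperplane gives a smooth map on the thickened simplex,
whose tangent map is unambiguous and continuous. On vectors of sum zero it agrees with any
derivative of φ within the simplex. -/
lemma exists_continuousOn_length_param (g : Metric n X) (hσ : σ ∈ T.complex) [Nonempty σ] :
    ∃ ℓ : (σ → ℝ) × (σ → ℝ) → ℝ, ContinuousOn ℓ (stdSimplex ℝ σ ×ˢ univ) ∧
      ∀ p ∈ stdSimplex ℝ σ, ∀ L : TangentSpace 𝓘(ℝ, σ → ℝ) p →L[ℝ] TangentSpace (𝓡 n) (T.param σ p),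
        HasMFDerivWithinAt 𝓘(ℝ, σ → ℝ) (𝓡 n) (T.param σ) (stdSimplex ℝ σ) p L →
        ∀ v : σ → ℝ, ∑ i, v i = 0 → ℓ (p, v) = length g (L v) := by
  set F : (σ → ℝ) → X := T.param σ ∘ toHyperplane σ
  have hFs : ContMDiffOn 𝓘(ℝ, σ → ℝ) (𝓡 n) ∞ F (thickSimplex σ) :=
    (T.smooth σ hσ).comp contDiff_toHyperplane.contMDiff.contMDiffOn fun x hx => hx
  have hU : UniqueMDiffOn 𝓘(ℝ, σ → ℝ) (thickSimplex σ) :=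
    uniqueDiffOn_thickSimplex.uniqueMDiffOn
  have hI : IsManifold (𝓡 n) 1 X := IsManifold.of_le (n := ∞) (by simp)
  have hc := hFs.continuousOn_tangentMapWithin (by simp) hU
  set s : (σ → ℝ) × (σ → ℝ) → TangentBundle 𝓘(ℝ, σ → ℝ) (σ → ℝ) := fun q => ⟨q.1, q.2⟩
  have hs' : Continuous s := (tangentBundleModelSpaceHomeomorph 𝓘(ℝ, σ → ℝ)).symm.continuous
  refine ⟨fun q => length g (tangentMapWithin 𝓘(ℝ, σ → ℝ) (𝓡 n) F (thickSimplex σ) (s q)).snd,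
    (continuous_length g).comp_continuousOn (hc.comp hs'.continuousOn fun q hq =>
      stdSimplex_subset_thickSimplex hq.1), fun p hp L hL v hv => ?_⟩
  have hpp : toHyperplane σ p = p := toHyperplane_of_sum_eq_one hp.2
  have h₁ : HasMFDerivWithinAt 𝓘(ℝ, σ → ℝ) (𝓡 n) (T.param σ) (stdSimplex ℝ σ)
      (toHyperplane σ p) L := by
    rw [hpp]
    exact hL
  have h₂ : HasMFDerivWithinAt 𝓘(ℝ, σ → ℝ) 𝓘(ℝ, σ → ℝ) (toHyperplane σ) (thickSimplex σ) p
      (toHyperplaneDeriv σ) := (hasFDerivAt_toHyperplane p).hasMFDerivAt.hasMFDerivWithinAt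
  have h₃ := (HasMFDerivWithinAt.comp p h₁ h₂ fun x hx => hx).mfderivWithin
    (hU p (stdSimplex_subset_thickSimplex hp))
  have h₄ : mfderivWithin 𝓘(ℝ, σ → ℝ) (𝓡 n) F (thickSimplex σ) p v = L v := by
    rw [h₃]
    change L (toHyperplaneDeriv σ v) = L v
    rw [toHyperplaneDeriv_of_sum_eq_zero hv]
  change length g (mfderivWithin 𝓘(ℝ, σ → ℝ) (𝓡 n) F (thickSimplex σ) p v) = _
  rw [h₄]
  exact length_congr (congrArg (T.param σ) hpp) _

/-- The parametrization of a simplex distorts lengths by a bounded factor. -/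
lemma exists_length_param_bounds (g : Metric n X) (hσ : σ ∈ T.complex) [Nonempty σ] :
    ∃ c C : ℝ, 0 < c ∧ 0 ≤ C ∧ ∀ p ∈ stdSimplex ℝ σ,
      ∀ L : TangentSpace 𝓘(ℝ, σ → ℝ) p →L[ℝ] TangentSpace (𝓡 n) (T.param σ p),
        HasMFDerivWithinAt 𝓘(ℝ, σ → ℝ) (𝓡 n) (T.param σ) (stdSimplex ℝ σ) p L →
        ∀ v : σ → ℝ, ∑ i, v i = 0 →
          c * ∑ i, |v i| ≤ length g (L v) ∧ length g (L v) ≤ C * ∑ i, |v i| := by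
  obtain ⟨ℓ, hℓ, hℓL⟩ := exists_continuousOn_length_param g hσ
  set K : Set ((σ → ℝ) × (σ → ℝ)) :=
    stdSimplex ℝ σ ×ˢ {v : σ → ℝ | ∑ i, |v i| = 1 ∧ ∑ i, v i = 0}
  have hK : IsCompact K := (isCompact_stdSimplex ℝ σ).prod isCompact_sum_abs_eq_one
  have hℓK : ContinuousOn ℓ K := hℓ.mono (prod_mono subset_rfl (subset_univ _))
  obtain ⟨c, hc, hcK⟩ : ∃ c > 0, ∀ q ∈ K, c ≤ ℓ q := by
    rcases K.eq_empty_or_nonempty with he | hne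
    · exact ⟨1, one_pos, by simp [he]⟩
    · obtain ⟨⟨p, v⟩, ⟨hp, hv⟩, hmin⟩ := hK.exists_isMinOn hne hℓK
      refine ⟨ℓ (p, v), ?_, fun q hq => hmin hq⟩
      have hd := ((T.smooth σ hσ p hp).mdifferentiableWithinAt (by simp)).hasMFDerivWithinAt
      rw [hℓL p hp _ hd v hv.2]
      refine length_pos fun h => ?_
      have hv0 : v = 0 := T.immersive σ hσ p hp _ hd v hv.2 h
      have := hv.1
      simp [hv0] at this
  obtain ⟨C, hC⟩ := hK.exists_bound_of_continuousOn hℓK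
  refine ⟨c, max C 0, hc, le_max_right _ _, fun p hp L hL v hv => ?_⟩
  rcases eq_or_ne (∑ i, |v i|) 0 with h0 | h0
  · have : v = 0 := by
      funext i
      simpa using (Finset.sum_eq_zero_iff_of_nonneg fun i _ => abs_nonneg (v i)).1 h0 i
        (Finset.mem_univ i)
    subst this
    have e : L (0 : σ → ℝ) = 0 := map_zero L
    rw [e, length_zero]
    simp
  · set m : ℝ := ∑ i, |v i| with hm
    have hm0 : 0 < m := lt_of_le_of_ne (Finset.sum_nonneg fun i _ => abs_nonneg _) h0.symm
    set u : σ → ℝ := m⁻¹ • v with hu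
    have hu0 : ∑ i, u i = 0 := by
      simp only [hu, Pi.smul_apply, smul_eq_mul, ← Finset.mul_sum, hv, mul_zero]
    have huK : (p, u) ∈ K := by
      refine ⟨hp, ?_, hu0⟩
      simp only [hu, Pi.smul_apply, smul_eq_mul, abs_mul, ← Finset.mul_sum,
        abs_of_pos (inv_pos.2 hm0)]
      exact inv_mul_cancel₀ h0
    have e : length g (L v) = m * ℓ (p, u) := by
      rw [hℓL p hp L hL u hu0]
      have hvu : v = m • u := by rw [hu, smul_inv_smul₀ h0]
      have : L v = m • L u := by
        conv_lhs => rw [hvu]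
        exact map_smul L m u
      rw [this, length_smul, abs_of_pos hm0]
    rw [e, mul_comm c, mul_comm (max C 0)]
    exact ⟨mul_le_mul_of_nonneg_left (hcK _ huK) hm0.le, mul_le_mul_of_nonneg_left
      ((le_abs_self _).trans ((hC _ huK).trans (le_max_left _ _))) hm0.le⟩

variable {r : ℕ} {τ : Set (σ → ℝ)} {J : Finset σ} {M : (σ → ℝ) ≃ₗ[ℝ] (σ → ℝ)}

/-- Tangent vectors to the jiggling section, in terms of the parametrization of a simplex. -/
lemma IsCellParam.exists_of_mem_tangentVectors (h : IsCellParam r τ J M) (hρ : IsAdmissible g ρ)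
    (hT : IsFine g ρ T) (hσ : σ ∈ T.complex) {p : σ → ℝ} (hp : p ∈ τ)
    {z : TangentSpace (𝓡 n).tangent ((jiggling g ρ T r ∘ T.param σ) p)}
    (hz : z ∈ tangentVectors (jiggling g ρ T r ∘ T.param σ) τ p) :
    ∃ v : σ → ℝ, ∑ i, v i = 0 ∧ (v = 0 → z = 0) ∧
      (∃ L : TangentSpace 𝓘(ℝ, σ → ℝ) p →L[ℝ] TangentSpace (𝓡 n) (T.param σ p),
        HasMFDerivWithinAt 𝓘(ℝ, σ → ℝ) (𝓡 n) (T.param σ) (stdSimplex ℝ σ) p L ∧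
        mfderiv (𝓡 n).tangent (𝓡 n) (TotalSpace.proj : TangentBundle (𝓡 n) X → X)
          (jiggling g ρ T r (T.param σ p)) z = L v) ∧
      ∃ L : TangentSpace 𝓘(ℝ, σ → ℝ) (M.symm p) →L[ℝ]
          TangentSpace (𝓡 n) (T.param σ (M.symm p)),
        HasMFDerivWithinAt 𝓘(ℝ, σ → ℝ) (𝓡 n) (T.param σ) (stdSimplex ℝ σ) (M.symm p) L ∧
        (mfderiv (𝓡 n).tangent (𝓡 n) (expMap g) (jiggling g ρ T r (T.param σ p)) z :
          EuclideanSpace ℝ (Fin n)) = L (M.symm v) := by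
  obtain ⟨L, hL, v, hv, rfl⟩ := hz
  refine ⟨v, h.sum_eq_zero hv, fun hv0 => by rw [hv0]; exact map_zero L, ?_, ?_⟩
  · have h₁ := ((T.smooth σ hσ p (h.subset hp)).mdifferentiableWithinAt
      (by simp)).hasMFDerivWithinAt
    refine ⟨_, h₁, ?_⟩
    have h₂ := HasMFDerivAt.comp_hasMFDerivWithinAt p
      ((contMDiff_tangentBundle_proj.mdifferentiableAt (by simp)).hasMFDerivAt) hL
    exact eqOn_vectorSpan_of_hasMFDerivWithinAt h.convex hp h₂ (h₁.mono h.subset) hv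
  · have h₁ := ((T.smooth σ hσ _ (h.mapsTo_symm hp)).mdifferentiableWithinAt
      (by simp)).hasMFDerivWithinAt
    refine ⟨_, h₁, ?_⟩
    have hj : ∀ q, expMap g ((jiggling g ρ T r ∘ T.param σ) q) = T.fold r (T.param σ q) :=
      fun q => (jiggling_mem hρ hT r _).2
    have h₂ := (HasMFDerivAt.comp_hasMFDerivWithinAt (g := expMap g) p
      (((hρ.contMDiffAt_expMap (jiggling_mem hρ hT r _).1).mdifferentiableAt
        (by simp)).hasMFDerivAt) hL).congr_mono (f₁ := T.param σ ∘ M.symm) (t := τ)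
      (fun q hq => ((hj q).trans (h.fold_param hσ hq)).symm)
      ((hj p).trans (h.fold_param hσ hp)).symm subset_rfl
    have h₃ : HasMFDerivWithinAt 𝓘(ℝ, σ → ℝ) 𝓘(ℝ, σ → ℝ) M.symm τ p
        (M.symm.toLinearMap.toContinuousLinearMap) :=
      (M.symm.toLinearMap.toContinuousLinearMap.hasFDerivAt).hasMFDerivAt.hasMFDerivWithinAt
    exact eqOn_vectorSpan_of_hasMFDerivWithinAt h.convex hp h₂
      (HasMFDerivWithinAt.comp p h₁ h₃ h.mapsTo_symm) hv

end Bounds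

/-! ### Verticality against planes transverse to the fibres -/

section PlaneFields

variable {n : ℕ} {X : Type*} [TopologicalSpace X] [ChartedSpace (EuclideanSpace ℝ (Fin n)) X]
  [IsManifold (𝓡 n) ∞ X] {g : Metric n X} {ρ : X → ℝ}

/-- The length of the image of a tangent vector of `TX` under the differential of a map to `X`. -/
def lengthOfImage (g : Metric n X) (f : TangentBundle (𝓡 n) X → X)
    (Z : TangentBundle (𝓡 n).tangent (TangentBundle (𝓡 n) X)) : ℝ :=
  length g (mfderiv (𝓡 n).tangent (𝓡 n) f Z.proj Z.snd)

lemma continuousAt_lengthOfImage {f : TangentBundle (𝓡 n) X → X}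
    {D : Set (TangentBundle (𝓡 n) X)} (hD : IsOpen D)
    (hf : ContMDiffOn (𝓡 n).tangent (𝓡 n) ∞ f D)
    {Z : TangentBundle (𝓡 n).tangent (TangentBundle (𝓡 n) X)} (hZ : Z.proj ∈ D) :
    ContinuousAt (lengthOfImage g f) Z := by
  have h₁ : IsManifold (𝓡 n) 1 X := IsManifold.of_le (n := ∞) (by simp)
  have h₂ : IsManifold (𝓡 n).tangent 1 (TangentBundle (𝓡 n) X) :=
    IsManifold.of_le (n := ∞) (by simp)
  have hU : UniqueMDiffOn (𝓡 n).tangent D := hD.uniqueMDiffOn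
  have hc := hf.continuousOn_tangentMapWithin (by simp) hU
  have hopen : IsOpen (TotalSpace.proj ⁻¹' D :
      Set (TangentBundle (𝓡 n).tangent (TangentBundle (𝓡 n) X))) :=
    hD.preimage (FiberBundle.continuous_proj _
      (fun w : TangentBundle (𝓡 n) X => TangentSpace (𝓡 n).tangent w))
  have hlen : ContinuousAt (fun Z => length g
      (tangentMapWithin (𝓡 n).tangent (𝓡 n) f D Z).snd) Z :=
    ((continuous_length g).comp_continuousOn hc).continuousAt (hopen.mem_nhds hZ)
  refine hlen.congr ?_
  filter_upwards [hopen.mem_nhds hZ] with Y hY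
  have e : mfderivWithin (𝓡 n).tangent (𝓡 n) f D Y.proj =
      mfderiv (𝓡 n).tangent (𝓡 n) f Y.proj := mfderivWithin_of_isOpen hD hY
  change length g (mfderivWithin (𝓡 n).tangent (𝓡 n) f D Y.proj Y.snd) = _
  rw [e]
  rfl

lemma continuousAt_sum_smul {A : Type*} [TopologicalSpace A]
    {e : Fin n → (q : A × TangentBundle (𝓡 n) X) → TangentSpace (𝓡 n).tangent q.2}
    {q₀ : A × TangentBundle (𝓡 n) X}
    (he : ∀ i, ContinuousAt (fun q : A × TangentBundle (𝓡 n) X =>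
      (⟨q.2, e i q⟩ : TangentBundle (𝓡 n).tangent (TangentBundle (𝓡 n) X))) q₀) (c₀ : Fin n → ℝ) :
    ContinuousAt (fun x : (A × TangentBundle (𝓡 n) X) × (Fin n → ℝ) =>
      (⟨x.1.2, ∑ i, x.2 i • e i x.1⟩ :
        TangentBundle (𝓡 n).tangent (TangentBundle (𝓡 n) X))) (q₀, c₀) := by
  have h₂ : IsManifold (𝓡 n).tangent 1 (TangentBundle (𝓡 n) X) :=
    IsManifold.of_le (n := ∞) (by simp)
  set t := trivializationAt (EuclideanSpace ℝ (Fin n) × EuclideanSpace ℝ (Fin n))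
    (TangentSpace (𝓡 n).tangent : TangentBundle (𝓡 n) X → Type _) q₀.2 with ht
  have hb : ContinuousAt (fun x : (A × TangentBundle (𝓡 n) X) × (Fin n → ℝ) => x.1.2) (q₀, c₀) :=
    (continuous_snd.comp continuous_fst).continuousAt
  rw [FiberBundle.continuousAt_totalSpace]
  refine ⟨hb, ?_⟩
  have hsum : ContinuousAt (fun x : (A × TangentBundle (𝓡 n) X) × (Fin n → ℝ) =>
      ∑ i, x.2 i • (t ⟨x.1.2, e i x.1⟩).2) (q₀, c₀) := by
    refine tendsto_finsetSum _ fun i _ => ?_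
    have h := ((FiberBundle.continuousAt_totalSpace
      (EuclideanSpace ℝ (Fin n) × EuclideanSpace ℝ (Fin n)) _).1 (he i)).2
    exact ((continuous_apply i).comp continuous_snd).continuousAt.smul
      (ContinuousAt.comp (f := Prod.fst) (x := (q₀, c₀)) h continuous_fst.continuousAt)
  refine hsum.congr ?_
  have hmem : ∀ᶠ x in 𝓝 (q₀, c₀), x.1.2 ∈ t.baseSet :=
    hb.eventually (t.open_baseSet.mem_nhds (mem_baseSet_trivializationAt _ _ _))
  filter_upwards [hmem] with x hx
  have h := fun v : TangentSpace (𝓡 n).tangent x.1.2 =>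
    t.continuousLinearMapAt_apply_of_mem (R := ℝ) hx v
  simp only [← ht]
  rw [← h, map_sum]
  refine Finset.sum_congr rfl fun i _ => ?_
  rw [map_smul, h]

/-- At (a, w), transversality makes |dπ| positive on nonzero combinations of the spanning fields, so
|dexp| / |dπ| is bounded on the unit sphere of coefficients. The bound spreads to nearby points by
compactness of that sphere and to all coefficients by homogeneity. -/
lemma IsTransversePlaneFamily.exists_local_bound {A : Type*} [TopologicalSpace A]
    {P : A → (w : TangentBundle (𝓡 n) X) → Submodule ℝ (TangentSpace (𝓡 n).tangent w)}
    (hρ : IsAdmissible g ρ) (hP : IsTransversePlaneFamily (discBundle g ρ) P) (a : A)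
    {w : TangentBundle (𝓡 n) X} (hw : w ∈ discBundle g ρ) :
    ∃ C : ℝ, ∀ᶠ q in 𝓝 (a, w), ∀ z : TangentSpace (𝓡 n).tangent q.2, z ∈ P q.1 q.2 →
      lengthOfImage g (expMap g) ⟨q.2, z⟩ ≤ C * lengthOfImage g TotalSpace.proj ⟨q.2, z⟩ := by
  obtain ⟨U, hU, e, he, hspan⟩ := hP.continuous a w hw
  have hexp : ContMDiffOn (𝓡 n).tangent (𝓡 n) ∞ (expMap g) (discBundle g ρ) :=
    fun u hu => (hρ.contMDiffAt_expMap hu).contMDiffWithinAt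
  set s : (A × TangentBundle (𝓡 n) X) × (Fin n → ℝ) →
    TangentBundle (𝓡 n).tangent (TangentBundle (𝓡 n) X) :=
    fun x => ⟨x.1.2, ∑ i, x.2 i • e i x.1⟩
  have hsc : ∀ c, ContinuousAt s ((a, w), c) :=
    continuousAt_sum_smul fun i => (he i).continuousAt hU
  have h₁ : ∀ c, ContinuousAt (lengthOfImage g (expMap g) ∘ s) ((a, w), c) := fun c =>
    ContinuousAt.comp (continuousAt_lengthOfImage hρ.isOpen_discBundle hexp hw) (hsc c)
  have h₂ : ∀ c, ContinuousAt (lengthOfImage g TotalSpace.proj ∘ s) ((a, w), c) := fun c =>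
    ContinuousAt.comp (continuousAt_lengthOfImage isOpen_univ
      contMDiff_tangentBundle_proj.contMDiffOn (mem_univ _)) (hsc c)
  have hS : IsCompact (Metric.sphere (0 : Fin n → ℝ) 1) := isCompact_sphere 0 1
  have hpos : ∀ c ∈ Metric.sphere (0 : Fin n → ℝ) 1,
      0 < (lengthOfImage g TotalSpace.proj ∘ s) ((a, w), c) := by
    intro c hc
    have hspan' := hspan (a, w) (mem_of_mem_nhds hU)
    have hli : LinearIndependent ℝ fun i => e i (a, w) := by
      rw [linearIndependent_iff_card_eq_finrank_span, Fintype.card_fin, Set.finrank, ← hspan']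
      exact (hP.finrank a w hw).symm
    refine length_pos fun h0 => ?_
    have hz : ∑ i, c i • e i (a, w) = 0 := by
      refine (Submodule.mem_bot ℝ).1 ((hP.transverse a w hw).disjoint.le_bot ⟨?_, h0⟩)
      rw [hspan']
      exact Submodule.sum_mem _ fun i _ =>
        Submodule.smul_mem _ _ (Submodule.subset_span (mem_range_self i))
    have hc0 : c = 0 := funext fun i => Fintype.linearIndependent_iff.1 hli c hz i
    simp [hc0] at hc
  have hincl : ∀ c : Fin n → ℝ,
      ContinuousAt (fun c : Fin n → ℝ => ((a, w), c)) c := fun c => by fun_prop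
  obtain ⟨B, hB⟩ := hS.exists_bound_of_continuousOn
    (f := fun c => (lengthOfImage g (expMap g) ∘ s) ((a, w), c) /
      (lengthOfImage g TotalSpace.proj ∘ s) ((a, w), c)) fun c hc =>
      ((ContinuousAt.comp (f := fun c : Fin n → ℝ => ((a, w), c)) (h₁ c) (hincl c)).div
        (ContinuousAt.comp (f := fun c : Fin n → ℝ => ((a, w), c)) (h₂ c) (hincl c))
        (hpos c hc).ne').continuousWithinAt
  -- Using B + 1 makes the inequality strict, hence an open condition.
  have hev : ∀ᶠ q in 𝓝 (a, w), ∀ c ∈ Metric.sphere (0 : Fin n → ℝ) 1,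
      (lengthOfImage g (expMap g) ∘ s) (q, c) <
        (B + 1) * (lengthOfImage g TotalSpace.proj ∘ s) (q, c) := by
    refine hS.eventually_forall_of_forall_eventually fun c hc => ?_
    refine (h₁ c).eventually_lt (continuousAt_const.mul (h₂ c)) ?_
    have := (le_abs_self _).trans (hB c hc)
    rw [div_le_iff₀ (hpos c hc)] at this
    have := hpos c hc
    linarith
  refine ⟨B + 1, ?_⟩
  filter_upwards [hev, hU] with q hq hqU
  intro z hz
  rw [hspan q hqU] at hz
  obtain ⟨c, rfl⟩ := (Submodule.mem_span_range_iff_exists_fun ℝ).1 hz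
  rcases eq_or_ne c 0 with rfl | hc
  · have h0 : ∑ i, (0 : Fin n → ℝ) i • e i q = 0 :=
      Finset.sum_eq_zero fun i _ => by rw [Pi.zero_apply, zero_smul]
    have hlen : ∀ f : TangentBundle (𝓡 n) X → X,
        lengthOfImage g f ⟨q.2, ∑ i, (0 : Fin n → ℝ) i • e i q⟩ = 0 := by
      intro f
      rw [h0, lengthOfImage, map_zero, length_zero]
    rw [hlen, hlen, mul_zero]
  · have hc' : 0 < ‖c‖ := norm_pos_iff.2 hc
    have hz : ∑ i, c i • e i q = ‖c‖ • ∑ i, (‖c‖⁻¹ • c) i • e i q := by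
      rw [Finset.smul_sum]
      refine Finset.sum_congr rfl fun i _ => ?_
      rw [smul_smul, Pi.smul_apply, smul_eq_mul, mul_inv_cancel_left₀ hc'.ne']
    have key := hq (‖c‖⁻¹ • c) (by
      rw [mem_sphere_zero_iff_norm, norm_smul, norm_inv, norm_norm, inv_mul_cancel₀ hc'.ne'])
    have hsmul : ∀ f : TangentBundle (𝓡 n) X → X, lengthOfImage g f ⟨q.2, ∑ i, c i • e i q⟩ =
        ‖c‖ * (lengthOfImage g f ∘ s) (q, ‖c‖⁻¹ • c) := by
      intro f
      rw [hz]
      change length g (mfderiv (𝓡 n).tangent (𝓡 n) f q.2 (‖c‖ • _)) = _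
      rw [map_smul, length_smul, abs_of_pos hc']
      rfl
    rw [hsmul, hsmul, mul_left_comm]
    exact mul_le_mul_of_nonneg_left key.le hc'.le

lemma IsTransversePlaneFamily.exists_bound {A : Type*} [TopologicalSpace A] [CompactSpace A]
    {P : A → (w : TangentBundle (𝓡 n) X) → Submodule ℝ (TangentSpace (𝓡 n).tangent w)}
    (hρ : IsAdmissible g ρ) (hP : IsTransversePlaneFamily (discBundle g ρ) P)
    {Q : Set (TangentBundle (𝓡 n) X)} (hQ : IsCompact Q) (hQD : Q ⊆ discBundle g ρ) :
    ∃ C : ℝ, ∀ q ∈ (univ : Set A) ×ˢ Q, ∀ z : TangentSpace (𝓡 n).tangent q.2, z ∈ P q.1 q.2 →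
      lengthOfImage g (expMap g) ⟨q.2, z⟩ ≤ C * lengthOfImage g TotalSpace.proj ⟨q.2, z⟩ := by
  refine (isCompact_univ.prod hQ).induction_on
    (p := fun S => ∃ C : ℝ, ∀ q ∈ S, ∀ z : TangentSpace (𝓡 n).tangent q.2, z ∈ P q.1 q.2 →
      lengthOfImage g (expMap g) ⟨q.2, z⟩ ≤ C * lengthOfImage g TotalSpace.proj ⟨q.2, z⟩)
    ⟨0, by simp⟩ (fun S S' h ⟨C, hC⟩ => ⟨C, fun q hq => hC q (h hq)⟩) ?_ ?_
  · rintro S S' ⟨C, hC⟩ ⟨C', hC'⟩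
    refine ⟨max C C', fun q hq z hz => ?_⟩
    rcases hq with hq | hq
    · exact (hC q hq z hz).trans (mul_le_mul_of_nonneg_right (le_max_left _ _) (length_nonneg _))
    · exact (hC' q hq z hz).trans (mul_le_mul_of_nonneg_right (le_max_right _ _) (length_nonneg _))
  · rintro ⟨a, w⟩ ⟨-, hw⟩
    obtain ⟨C, hC⟩ := hP.exists_local_bound hρ a (hQD hw)
    exact ⟨_, mem_nhdsWithin_of_mem_nhds hC, C, fun q hq => hq⟩

variable {V : Type*} {T : SmoothTriangulation n X V}

/-- The iterated jigglings become vertical. -/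
lemma exists_forall_length_le (hρ : IsAdmissible g ρ) (hT : IsFine g ρ T) {σ : Finset V}
    (hσ : σ ∈ T.complex) {ε : ℝ} (hε : 0 < ε) :
    ∃ r₀ : ℕ, ∀ r ≥ r₀, ∀ τ ∈ iteratedThomSubdivision σ r, ∀ p ∈ τ,
      ∀ z ∈ tangentVectors (jiggling g ρ T r ∘ T.param σ) τ p,
        length g (mfderiv (𝓡 n).tangent (𝓡 n) (TotalSpace.proj : TangentBundle (𝓡 n) X → X)
            (jiggling g ρ T r (T.param σ p)) z) ≤
          ε * length g (mfderiv (𝓡 n).tangent (𝓡 n) (expMap g)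
            (jiggling g ρ T r (T.param σ p)) z) := by
  rcases isEmpty_or_nonempty σ with hσe | hσe
  · refine ⟨0, fun r _ τ hτ p hp => ?_⟩
    obtain ⟨J, M, h⟩ := exists_isCellParam hτ
    have := (h.subset hp).2
    simp at this
  obtain ⟨c, C, hc, hC, hb⟩ := exists_length_param_bounds g hσ
  have hlim : Filter.Tendsto (fun r => C * contractionRate σ ^ r) Filter.atTop (𝓝 (C * 0)) :=
    (tendsto_pow_atTop_nhds_zero_of_lt_one contractionRate_nonneg
      contractionRate_lt_one).const_mul C
  rw [mul_zero] at hlim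
  -- Here c and C are the lower and upper distortion factors of φ; the goal follows as soon as C κ^r
  -- < ε c.
  obtain ⟨r₀, hr₀⟩ := Filter.eventually_atTop.1
    (hlim.eventually (gt_mem_nhds (mul_pos hε hc)))
  refine ⟨r₀, fun r hr τ hτ p hp z hz => ?_⟩
  obtain ⟨J, M, h⟩ := exists_isCellParam hτ
  obtain ⟨v, hv, -, ⟨L, hL, hLz⟩, L', hL', hLz'⟩ := h.exists_of_mem_tangentVectors hρ hT hσ hp hz
  have h₁ := (hb p (h.subset hp) L hL v hv).2
  have h₂ := (hb _ (h.mapsTo_symm hp) L' hL' (M.symm v) ((h.sum_symm_eq v).trans hv)).1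
  have e : length g (mfderiv (𝓡 n).tangent (𝓡 n) (expMap g)
      (jiggling g ρ T r (T.param σ p)) z) = length g (L' (M.symm v)) := by
    refine (congrArg (fun u : EuclideanSpace ℝ (Fin n) => length g
      (x := expMap g (jiggling g ρ T r (T.param σ p))) u) hLz').trans (length_congr ?_ _)
    exact (jiggling_mem hρ hT r _).2.trans (h.fold_param hσ hp)
  have e' : length g (mfderiv (𝓡 n).tangent (𝓡 n)
      (TotalSpace.proj : TangentBundle (𝓡 n) X → X) (jiggling g ρ T r (T.param σ p)) z) =
      length g (L v) :=
    congrArg (fun u : EuclideanSpace ℝ (Fin n) => length g (x := T.param σ p) u) hLz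
  rw [e, e']
  have hm : 0 ≤ ∑ i, |M.symm v i| := Finset.sum_nonneg fun i _ => abs_nonneg _
  calc length g (L v) ≤ C * ∑ i, |v i| := h₁
    _ ≤ C * (contractionRate σ ^ r * ∑ i, |M.symm v i|) :=
      mul_le_mul_of_nonneg_left (h.sum_abs_le_symm hv) hC
    _ = C * contractionRate σ ^ r * ∑ i, |M.symm v i| := (mul_assoc _ _ _).symm
    _ ≤ ε * c * ∑ i, |M.symm v i| := mul_le_mul_of_nonneg_right (hr₀ r hr).le hm
    _ = ε * (c * ∑ i, |M.symm v i|) := mul_assoc _ _ _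
    _ ≤ ε * length g (L' (M.symm v)) := mul_le_mul_of_nonneg_left h₂ hε.le

/-- All iterated jigglings are quasi-transverse to the exponential foliation, as the iterated
folding maps are immersive on the simplices of the subdivisions. -/
lemma isQuasiTransverse_expFoliation (hρ : IsAdmissible g ρ) (hT : IsFine g ρ T) (r : ℕ) :
    IsQuasiTransverse T r (jiggling g ρ T r) (expFoliation g) := by
  intro σ hσ τ hτ p hp z hz hzP
  obtain ⟨J, M, h⟩ := exists_isCellParam hτ
  obtain ⟨v, hv, hv0, -, L, hL, hLz⟩ := h.exists_of_mem_tangentVectors hρ hT hσ hp hz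
  refine hv0 (M.symm.map_eq_zero_iff.1 ?_)
  exact T.immersive σ hσ _ (h.mapsTo_symm hp) L hL _ ((h.sum_symm_eq v).trans hv)
    (hLz.symm.trans hzP)

lemma exists_forall_eq_zero_of_mem_plane {A : Type*} [TopologicalSpace A] [CompactSpace A]
    {P : A → (w : TangentBundle (𝓡 n) X) → Submodule ℝ (TangentSpace (𝓡 n).tangent w)}
    (hρ : IsAdmissible g ρ) (hT : IsFine g ρ T)
    (hP : IsTransversePlaneFamily (discBundle g ρ) P) {σ : Finset V} (hσ : σ ∈ T.complex) :
    ∃ r₀ : ℕ, ∀ r ≥ r₀, ∀ a : A, ∀ τ ∈ iteratedThomSubdivision σ r, ∀ p ∈ τ,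
      ∀ z ∈ tangentVectors (jiggling g ρ T r ∘ T.param σ) τ p,
        z ∈ P a (jiggling g ρ T r (T.param σ p)) → z = 0 := by
  -- This compact set contains the jigglings of σ for all r at once, so C can be chosen before r.
  set Q : Set (TangentBundle (𝓡 n) X) := expInv g ρ '' (T.cell σ ×ˢ T.cell σ)
  have hcell := SmoothTriangulation.isCompact_cell hσ
  have hQ : IsCompact Q := (hcell.prod hcell).image_of_continuousOn fun q hq =>
    (contMDiffAt_expInv hρ hT hσ hq.1 hq.2).continuousAt.continuousWithinAt
  have hQD : Q ⊆ discBundle g ρ := by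
    rintro _ ⟨q, hq, rfl⟩
    exact (expInv_mem hρ hT hσ hq.1 hq.2).1
  obtain ⟨C, hC⟩ := hP.exists_bound hρ hQ hQD
  have hC1 : 0 < |C| + 1 := by positivity
  -- With this ε, a vector with |dπ| > 0 would satisfy (|C| + 1) |dπ| ≤ |dexp| ≤ C |dπ|, which is
  -- impossible.
  obtain ⟨r₀, hr₀⟩ := exists_forall_length_le hρ hT hσ (inv_pos.2 hC1)
  refine ⟨r₀, fun r hr a τ hτ p hp z hz hzP => ?_⟩
  obtain ⟨J, M, h⟩ := exists_isCellParam hτ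
  have hx := SmoothTriangulation.param_mem_cell (T := T) (h.subset hp)
  have hjQ : jiggling g ρ T r (T.param σ p) ∈ Q :=
    ⟨(T.param σ p, T.fold r (T.param σ p)),
      ⟨hx, SmoothTriangulation.fold_mem_cell hσ hx r⟩, rfl⟩
  have h₁ := hr₀ r hr τ hτ p hp z hz
  have h₂ := hC (a, jiggling g ρ T r (T.param σ p)) ⟨mem_univ a, hjQ⟩ z hzP
  change length g (mfderiv (𝓡 n).tangent (𝓡 n) (expMap g)
      (jiggling g ρ T r (T.param σ p)) z) ≤ C * length g (mfderiv (𝓡 n).tangent (𝓡 n)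
      (TotalSpace.proj : TangentBundle (𝓡 n) X → X) (jiggling g ρ T r (T.param σ p)) z) at h₂
  have hvert : mfderiv (𝓡 n).tangent (𝓡 n) (TotalSpace.proj : TangentBundle (𝓡 n) X → X)
      (jiggling g ρ T r (T.param σ p)) z = 0 := by
    by_contra hne
    have hpos := length_pos (g := g) hne
    set ℓ := length g (mfderiv (𝓡 n).tangent (𝓡 n) (TotalSpace.proj : TangentBundle (𝓡 n) X → X)
      (jiggling g ρ T r (T.param σ p)) z)
    rw [inv_mul_eq_div, le_div_iff₀ hC1] at h₁
    have h₃ := mul_le_mul_of_nonneg_right (le_abs_self C) hpos.le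
    linarith
  exact (Submodule.mem_bot ℝ).1 ((hP.transverse a _ (hQD hjQ)).disjoint.le_bot ⟨hzP, hvert⟩)

lemma exists_isQuasiTransverse [CompactSpace X] {A : Type*} [TopologicalSpace A] [CompactSpace A]
    {P : A → (w : TangentBundle (𝓡 n) X) → Submodule ℝ (TangentSpace (𝓡 n).tangent w)}
    (hρ : IsAdmissible g ρ) (hT : IsFine g ρ T)
    (hP : IsTransversePlaneFamily (discBundle g ρ) P) :
    ∃ r₀ : ℕ, ∀ r ≥ r₀, ∀ a : A, IsQuasiTransverse T r (jiggling g ρ T r) (P a) := by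
  -- Only finitely many cells are nonempty, and the others contain no point to test.
  have hfin := T.locallyFinite.finite_nonempty_of_compact
  choose r₀ hr₀ using fun σ : {σ : Finset V // σ ∈ T.complex} =>
    exists_forall_eq_zero_of_mem_plane hρ hT hP σ.2
  refine ⟨hfin.toFinset.sup r₀, fun r hr a σ hσ τ hτ p hp z hz hzP => ?_⟩
  obtain ⟨J, M, h⟩ := exists_isCellParam hτ
  have hσfin : (⟨σ, hσ⟩ : {σ : Finset V // σ ∈ T.complex}) ∈ hfin.toFinset :=
    hfin.mem_toFinset.2 ⟨_, SmoothTriangulation.param_mem_cell (h.subset hp)⟩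
  exact hr₀ ⟨σ, hσ⟩ r ((Finset.le_sup hσfin).trans hr) a τ hτ p hp z hz hzP

end PlaneFields

end Jiggling

end

theorem mainTheorem2 {n : ℕ} {X : Type*} [TopologicalSpace X] [T2Space X]
    [ChartedSpace (EuclideanSpace ℝ (Fin n)) X] [IsManifold (𝓡 n) ∞ X]
    (g : Jiggling.Metric n X) (ρ : X → ℝ) (hρ : Jiggling.IsAdmissible g ρ)
    {V : Type*} (T : Jiggling.SmoothTriangulation n X V) (hT : Jiggling.IsFine g ρ T) :
    -- each `j⁽ʳ⁾` is a well-defined, continuous, piecewise smooth section of `DX`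
    (∀ r : ℕ,
      (∀ x, Jiggling.jiggling g ρ T r x ∈ Jiggling.discBundle g ρ ∧
        (Jiggling.jiggling g ρ T r x).proj = x ∧
        Jiggling.expMap g (Jiggling.jiggling g ρ T r x) = T.fold r x) ∧
      Continuous (Jiggling.jiggling g ρ T r) ∧
      ∀ σ ∈ T.complex, ∀ τ ∈ Jiggling.iteratedThomSubdivision σ r,
        ContMDiffOn 𝓘(ℝ, σ → ℝ) (𝓡 n).tangent ∞ (Jiggling.jiggling g ρ T r ∘ T.param σ) τ) ∧
    -- the larger `r` is, the more vertical the jiggling is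
    (∀ σ ∈ T.complex, ∀ ε : ℝ, 0 < ε → ∃ r₀ : ℕ, ∀ r ≥ r₀,
      ∀ τ ∈ Jiggling.iteratedThomSubdivision σ r, ∀ p ∈ τ,
      ∀ z ∈ Jiggling.tangentVectors (Jiggling.jiggling g ρ T r ∘ T.param σ) τ p,
        Jiggling.length g (mfderiv (𝓡 n).tangent (𝓡 n)
            (TotalSpace.proj : TangentBundle (𝓡 n) X → X)
            (Jiggling.jiggling g ρ T r (T.param σ p)) z) ≤
          ε * Jiggling.length g (mfderiv (𝓡 n).tangent (𝓡 n) (Jiggling.expMap g)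
            (Jiggling.jiggling g ρ T r (T.param σ p)) z)) ∧
    -- for `r` large it is quasi-transverse to the exponential foliation
    (∃ r₀ : ℕ, ∀ r ≥ r₀,
      Jiggling.IsQuasiTransverse T r (Jiggling.jiggling g ρ T r) (Jiggling.expFoliation g)) ∧
    -- if `X` is compact, this holds uniformly for compact families of transverse `n`-plane fields
    (CompactSpace X → ∀ (A : Type*) [TopologicalSpace A] [CompactSpace A]
      (P : A → (w : TangentBundle (𝓡 n) X) → Submodule ℝ (TangentSpace (𝓡 n).tangent w)),
      Jiggling.IsTransversePlaneFamily (Jiggling.discBundle g ρ) P →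
      ∃ r₀ : ℕ, ∀ r ≥ r₀, ∀ a : A,
        Jiggling.IsQuasiTransverse T r (Jiggling.jiggling g ρ T r) (P a)) := by
  refine ⟨fun r => ⟨fun x => ⟨(Jiggling.jiggling_mem hρ hT r x).1, rfl,
    (Jiggling.jiggling_mem hρ hT r x).2⟩, Jiggling.continuous_jiggling hρ hT r,
    fun σ hσ τ hτ => Jiggling.contMDiffOn_jiggling hρ hT hσ hτ⟩,
    fun σ hσ ε hε => Jiggling.exists_forall_length_le hρ hT hσ hε,
    ⟨0, fun r _ => Jiggling.isQuasiTransverse_expFoliation hρ hT r⟩, ?_⟩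
  intro _ A _ _ P hP
  exact Jiggling.exists_isQuasiTransverse hρ hT hP
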